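/- A Wang tile is a unit square with colored edges, written $(r,t,l,b)$ for its right, top, left and bottom colors. For a finite set $\mathcal{T}$ of Wang tiles, $\Omega_{\mathcal{T}}\subset\mathcal{T}^{\mathbb{Z}^2}$ denotes the set of valid tilings of $\mathbb{Z}^2$ (adjacent tiles have the same color on their common edge). Let $\sigma$ be the shift action of $\mathbb{Z}^2$. Let $\Omega_0=\Omega_{\mathcal{T}_0}$, where $\mathcal{T}_0$ is the set of 11 Jeandel–Rao tiles $(2,4,2,1)$, $(2,2,2,0)$, $(1,1,3,1)$, $(1,2,3,2)$, $(3,1,3,3)$, $(0,1,3,1)$, $(0,0,0,1)$, $(3,1,0,2)$, $(0,2,1,2)$, $(1,2,1,4)$, $(3,3,1,2)$, and let $\mathcal{U}$ be the set of 19 Wang tiles FOJO, FOHL, JMFP, DMFK, HPJP, HPHN, HKFP, HKDP, BOIO, GLEO, GLCL, ALIO, EPGP, EPIP, IPGK, IPIK, IKBM, IKAK, CNIP (letters are colors, in the order right, top, left, bottom). Theorem. There is a subshift (a closed shift-invariant set) $X_0\subseteq\Omega_0$ that is aperiodic ($X_0\neq\varnothing$ and no $x\in X_0$ has a nonzero period)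 and minimal (it contains no nonempty proper closed shift-invariant subset), and there are patches $P_u$ ($u\in\mathcal{U}$), that is, maps from finite subsets of $\mathbb{Z}^2$ to $\mathcal{T}_0$, no two of which are translates of each other, such that: 1. Two of the 19 patches have 45 cells, four have 70 cells, six have 72 cells and seven have 112 cells. 2. Every $x\in X_0$ decomposes in exactly one way into translates of the patches $P_u$ (that is, there is exactly one set of occurrences of translates of the $P_u$ in $x$ that covers each cell of $\mathbb{Z}^2$ exactly once), and each of the 19 patches is used in this decomposition. 3. The patches are equivalent to the Wang tiles in $\mathcal{U}$: there are vectors $h_u,v_u\in\mathbb{Z}^2$ ($u\in\mathcal{U}$) such that the cells $(0,0)$, $h_u-(1,0)$ and $v_u-(0,1)$ belong to the support of $P_u$, and the following holds. Say that $w:\mathbb{Z}^2\to\mathcal{U}$ describes $x$ if $x$ has a decomposition consisting of the translates of $P_{w(n)}$ by $p(n)$, $n\in\mathbb{Z}^2$, for some injective $p:\mathbb{Z}^2\to\mathbb{Z}^2$ with $p(n+(1,0))=p(n)+h_{w(n)}$ and $p(n+(0,1))=p(n)+v_{w(n)}$ for all $n$. Then every $x\in X_0$ is described by some $w\in\Omega_{\mathcal{U}}$,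 and a map $w:\mathbb{Z}^2\to\mathcal{U}$ belongs to $\Omega_{\mathcal{U}}$ if and only if it describes some $x\in X_0$. 4. $\Omega_{\mathcal{U}}$ is self-similar: there is a two-dimensional morphism $\omega$, sending each tile of $\mathcal{U}$ to a rectangular word over $\mathcal{U}$, which is expansive (for every letter $a$ and every $K$, some iterate $\omega^m(a)$ has both sides longer than $K$), is defined on all of $\Omega_{\mathcal{U}}$ (the images of the letters of a tiling can be concatenated), and satisfies $\Omega_{\mathcal{U}}=\{\sigma^k\omega(x) : x\in\Omega_{\mathcal{U}},\ k\in\mathbb{Z}^2\}$. -/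

import Mathlib

/-! ### Configurations, shift action, subshifts -/

/-- The shift action of `ℤ²` on configurations `ℤ² → A`: `(σⁿ x)ₘ = x_{m+n}`. -/
def shift {A : Type} (n : ℤ × ℤ) (x : ℤ × ℤ → A) : ℤ × ℤ → A :=
  fun m => x (m + n)

/-- `σⁿ(X) = X` for every `n`. -/
def IsShiftInvariant {A : Type} (X : Set (ℤ × ℤ → A)) : Prop :=
  ∀ n : ℤ × ℤ, shift n '' X = X

/-- A subshift is a closed (for the product of the discrete topologies) and shift-invariant set of
configurations. -/
def IsSubshift {A : Type} [TopologicalSpace A] [DiscreteTopology A]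
    (X : Set (ℤ × ℤ → A)) : Prop :=
  IsClosed X ∧ IsShiftInvariant X

/-- `X` contains no nonempty proper closed shift-invariant subset. -/
def IsMinimalSubshift {A : Type} [TopologicalSpace A] [DiscreteTopology A]
    (X : Set (ℤ × ℤ → A)) : Prop :=
  IsSubshift X ∧ ∀ Y : Set (ℤ × ℤ → A), Y ⊆ X → Y.Nonempty → IsSubshift Y → Y = X

/-- `X` is nonempty and none of its elements has a nonzero period. -/
def IsAperiodic {A : Type} (X : Set (ℤ × ℤ → A)) : Prop :=
  X.Nonempty ∧ ∀ x ∈ X, ∀ n : ℤ × ℤ, n ≠ 0 → shift n x ≠ x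

/-! ### Wang tiles -/

/-- A Wang tile with edge colors in `C`; the anonymous constructor lists the colors in the order
right, top, left, bottom. -/
structure WangTile (C : Type) where
  right : C
  top : C
  left : C
  bottom : C

/-- The Wang shift of a family of Wang tiles: the valid tilings of `ℤ²`, a tile being identified
with its index. -/
def wangShift {C ι : Type} (τ : ι → WangTile C) : Set (ℤ × ℤ → ι) :=
  {x | ∀ n : ℤ × ℤ, (τ (x n)).right = (τ (x (n + (1, 0)))).left ∧
    (τ (x n)).top = (τ (x (n + (0, 1)))).bottom}

/-- The 11 Wang tiles of Jeandel and Rao. -/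
def jeandelRao : Fin 11 → WangTile ℕ :=
  ![⟨2, 4, 2, 1⟩, ⟨2, 2, 2, 0⟩, ⟨1, 1, 3, 1⟩, ⟨1, 2, 3, 2⟩, ⟨3, 1, 3, 3⟩, ⟨0, 1, 3, 1⟩,
    ⟨0, 0, 0, 1⟩, ⟨3, 1, 0, 2⟩, ⟨0, 2, 1, 2⟩, ⟨1, 2, 1, 4⟩, ⟨3, 3, 1, 2⟩]

/-- The edge colors of the tiles `𝒰`: `A`–`J` on vertical edges, `K`–`P` on horizontal edges. -/
inductive ColorU where
  | A | B | C | D | E | F | G | H | I | J | K | L | M | N | O | P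
  deriving DecidableEq

open ColorU in
/-- The set `𝒰` of 19 Wang tiles. -/
def tilesU : Fin 19 → WangTile ColorU :=
  ![⟨F, O, J, O⟩, ⟨F, O, H, L⟩, ⟨J, M, F, P⟩, ⟨D, M, F, K⟩, ⟨H, P, J, P⟩, ⟨H, P, H, N⟩,
    ⟨H, K, F, P⟩, ⟨H, K, D, P⟩, ⟨B, O, I, O⟩, ⟨G, L, E, O⟩, ⟨G, L, C, L⟩, ⟨A, L, I, O⟩,
    ⟨E, P, G, P⟩, ⟨E, P, I, P⟩, ⟨I, P, G, K⟩, ⟨I, P, I, K⟩, ⟨I, K, B, M⟩, ⟨I, K, A, K⟩,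
    ⟨C, N, I, P⟩]

/-! ### Two-dimensional morphisms and self-similarity -/

/-- A two-dimensional word of shape `(width, height)`; `letter i j` is the letter in column `i`
(from the left) and row `j` (from the bottom). -/
structure Word2 (A : Type) where
  width : ℕ
  height : ℕ
  letter : Fin width → Fin height → A

/-- The word of shape `(1, 1)` with letter `a`. -/
def Word2.single {A : Type} (a : A) : Word2 A := ⟨1, 1, fun _ _ => a⟩

/-- `v = s(u)`: the images under `s` of the letters of `u` can be concatenated (images of letters
in the same column have the same width, in the same row the same height) and the result is `v`.
The image of column `i` of `u` starts in column `X i` of `v`, the image of row `j` in row `Y j`. -/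
def IsImageWord {A B : Type} (s : A → Word2 B) (u : Word2 A) (v : Word2 B) : Prop :=
  ∃ X Y : ℕ → ℕ, X 0 = 0 ∧ Y 0 = 0 ∧ v.width = X u.width ∧ v.height = Y u.height ∧
    ∀ (i : Fin u.width) (j : Fin u.height),
      X (i + 1) = X i + (s (u.letter i j)).width ∧
      Y (j + 1) = Y j + (s (u.letter i j)).height ∧
      ∀ (a : Fin (s (u.letter i j)).width) (b : Fin (s (u.letter i j)).height)
        (p : Fin v.width) (q : Fin v.height),
        (p : ℕ) = X i + a → (q : ℕ) = Y j + b → v.letter p q = (s (u.letter i j)).letter a b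

/-- `v = sᵐ(a)`. -/
def IsIteratedImage {A : Type} (s : A → Word2 A) (a : A) : ℕ → Word2 A → Prop
  | 0, v => v = Word2.single a
  | m + 1, v => ∃ u, IsIteratedImage s a m u ∧ IsImageWord s u v

/-- For every letter `a` and every `K`, both sides of `sᵐ(a)` exceed `K` for some `m`. -/
def IsExpansive {A : Type} (s : A → Word2 A) : Prop :=
  ∀ (a : A) (K : ℕ), ∃ (m : ℕ) (v : Word2 A),
    IsIteratedImage s a m v ∧ K < v.width ∧ K < v.height

/-- `y = s(x)` for configurations: the images of the letters of `x` are concatenated, the lower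
left corner of the image of `x₀` being at the origin. -/
def IsImageConfig {A B : Type} (s : A → Word2 B) (x : ℤ × ℤ → A) (y : ℤ × ℤ → B) : Prop :=
  ∃ X Y : ℤ → ℤ, X 0 = 0 ∧ Y 0 = 0 ∧
    ∀ i j : ℤ,
      X (i + 1) = X i + (s (x (i, j))).width ∧
      Y (j + 1) = Y j + (s (x (i, j))).height ∧
      ∀ (a : Fin (s (x (i, j))).width) (b : Fin (s (x (i, j))).height),
        y (X i + a, Y j + b) = (s (x (i, j))).letter a b

/-- `X` is self-similar: there is an expansive two-dimensional morphism `s`, defined on all of `X`,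
such that `X` is the closure under the shift of `s(X)`. -/
def IsSelfSimilar {A : Type} (X : Set (ℤ × ℤ → A)) : Prop :=
  ∃ s : A → Word2 A, IsExpansive s ∧ (∀ x ∈ X, ∃ y, IsImageConfig s x y) ∧
    X = {z | ∃ x ∈ X, ∃ (y : ℤ × ℤ → A) (k : ℤ × ℤ), IsImageConfig s x y ∧ z = shift k y}

/-! ### Patches and decompositions -/

/-- A patch: a map from a finite subset of `ℤ²` to `A`. -/
structure Patch (A : Type) where
  support : Finset (ℤ × ℤ)
  val : support → A

/-- The number of cells of a patch. -/
def Patch.size {A : Type} (p : Patch A) : ℕ := p.support.card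

/-- The copy of `p` translated by `k` appears in `x`. -/
def Patch.OccursAt {A : Type} (p : Patch A) (x : ℤ × ℤ → A) (k : ℤ × ℤ) : Prop :=
  ∀ m : p.support, x (k + m) = p.val m

/-- `q` is the translate of `p` by some vector. -/
def Patch.IsTranslate {A : Type} (p q : Patch A) : Prop :=
  ∃ k : ℤ × ℤ, (∀ m, m ∈ p.support ↔ k + m ∈ q.support) ∧
    ∀ (m : p.support) (m' : q.support), (m' : ℤ × ℤ) = k + m → q.val m' = p.val m

/-- `D` is a decomposition of `x` into translates of the patches `P i`: a set of pairs `(k, i)`, such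
that the translate of `P i` by `k` appears in `x`, and every cell of `ℤ²` is covered exactly once. -/
def IsDecomposition {A ι : Type} (P : ι → Patch A) (x : ℤ × ℤ → A)
    (D : Set ((ℤ × ℤ) × ι)) : Prop :=
  (∀ d ∈ D, (P d.2).OccursAt x d.1) ∧
  ∀ m : ℤ × ℤ, ∃! d : (ℤ × ℤ) × ι, d ∈ D ∧ m - d.1 ∈ (P d.2).support

/-- The patches of a decomposition `D`, placed at `pos n` for `n ∈ ℤ²`, are arranged like the
letters of the configuration `w`: the patch of index `n` is `P (w n)`, and the patches of indices
`n + (1, 0)` and `n + (0, 1)` are placed at displacements `h (w n)` and `v (w n)` from it. -/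
def IsArrangedAs {ι : Type} (h v : ι → ℤ × ℤ) (D : Set ((ℤ × ℤ) × ι)) (w : ℤ × ℤ → ι) : Prop :=
  ∃ pos : ℤ × ℤ → ℤ × ℤ, Function.Injective pos ∧
    (∀ n, pos (n + (1, 0)) = pos n + h (w n)) ∧
    (∀ n, pos (n + (0, 1)) = pos n + v (w n)) ∧
    D = Set.range fun n => (pos n, w n)

/-- The patches `P i` are equivalent, in the subshift `X`, to the Wang tiles `τ i`. The vectors
`h i` and `v i` give the places of the right and of the upper neighbor of a patch `P i`: these have
their origin cells immediately to the right of a cell of `P i`, respectively immediately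
above a cell of `P i`. The elements of `X` decompose into patches arranged like valid tilings by the
Wang tiles `τ`, and the arrangements obtained in this way are exactly the valid tilings. -/
def PatchesEquivalentToTiles {A C ι : Type} (X : Set (ℤ × ℤ → A)) (P : ι → Patch A)
    (τ : ι → WangTile C) : Prop :=
  ∃ h v : ι → ℤ × ℤ,
    (∀ i, (0, 0) ∈ (P i).support ∧ h i - (1, 0) ∈ (P i).support ∧
      v i - (0, 1) ∈ (P i).support) ∧
    (∀ x ∈ X, ∃ w ∈ wangShift τ, ∃ D, IsDecomposition P x D ∧ IsArrangedAs h v D w) ∧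
    (∀ w : ℤ × ℤ → ι,
      w ∈ wangShift τ ↔ ∃ x ∈ X, ∃ D, IsDecomposition P x D ∧ IsArrangedAs h v D w)

/-! ### Subdivisions of `ℤ` into intervals -/

/-! Tilings by `𝒰` are understood by desubstitution. A finite list bounds their 2 × 2 patterns. It
shows that rows are short or tall and columns narrow or wide, that no two short rows and no two
narrow columns are adjacent, and that any three consecutive rows (columns) include a short (narrow)
one. In the image of a letter, narrow tiles fill exactly the second column and short tiles exactly
the bottom row; hence the blocks of any tiling can be located and read back as letters
(`exists_desubstitution`). Two letters match exactly when the facing sides of their images match, so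
images and preimages of tilings are tilings, and self-similarity follows.

Blocks have sides at least 2. Iterated images therefore grow, and compactness yields a tiling;
desubstitution at least halves a period, so descent excludes periods (`eq_zero_of_period`); and a
square pattern comes from a smaller one, so minimality reduces to 2 × 2 patterns, where a finite
primitivity check suffices (`isRecurrent_of_mem_quads`, `exists_occurrence`).

The patches are sheared rectangles, 5 or 8 wide and 9 or 14 high, that fit together in the
combinatorial pattern of a tiling by `𝒰`; a finite check of 3 × 2 arrangements gives matching
Jeandel–Rao colors. The link back is rigidity: every patch contains a pair of tiles that occurs in a
patchwork at one place of a patch only, so every occurrence of a patch starts where a patch of the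
patchwork starts (`IsPatchwork.exists_pos_eq`). This makes decompositions unique
(`IsPatchwork.decomposition_unique`). A patchwork thus determines its tiling up to a shift of
indices, which transfers aperiodicity and gives the equivalence with `𝒰`. Closedness and minimality
pass through the closed set of pairs `standardPatchworks`. -/

theorem StrictMono.add_le_int {X : ℤ → ℤ} (hX : StrictMono X) (k : ℤ) {n : ℤ} (hn : 0 ≤ n) :
    X k + n ≤ X (k + n) := by
  induction n, hn using Int.leInduction with
  | base => simp
  | succ n _ ih =>
    have := hX (show k + n < k + (n + 1) by omega)
    omega

/-- The intervals `[X k, X (k + 1))` cover `ℤ`. -/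
theorem StrictMono.exists_int_index {X : ℤ → ℤ} (hX : StrictMono X) (m : ℤ) :
    ∃ k, X k ≤ m ∧ m < X (k + 1) := by
  -- A strictly increasing integer sequence gains at least 1 per step, which bounds the candidates
  -- for the greatest index.
  have hb : ∀ z, X z ≤ m → z ≤ |m - X 0| := by
    intro z hz
    by_contra h
    have h0 : 0 ≤ z := by have := abs_nonneg (m - X 0); omega
    have := hX.add_le_int 0 h0
    rw [zero_add] at this
    have := le_abs_self (m - X 0)
    omega
  have hne : ∃ z, X z ≤ m := by
    refine ⟨-|m - X 0|, ?_⟩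
    have := hX.add_le_int (-|m - X 0|) (abs_nonneg (m - X 0))
    rw [neg_add_cancel] at this
    have := neg_abs_le (m - X 0)
    omega
  obtain ⟨k, hk, hmax⟩ := Int.exists_greatest_of_bdd ⟨_, hb⟩ hne
  refine ⟨k, hk, ?_⟩
  by_contra h
  have := hmax (k + 1) (by omega)
  omega

theorem StrictMono.int_index_unique {X : ℤ → ℤ} (hX : StrictMono X) {m k l : ℤ}
    (hk : X k ≤ m) (hk' : m < X (k + 1)) (hl : X l ≤ m) (hl' : m < X (l + 1)) : k = l := by
  have h1 : k < l + 1 := hX.lt_iff_lt.1 (hk.trans_lt hl')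
  have h2 : l < k + 1 := hX.lt_iff_lt.1 (hl.trans_lt hk')
  omega

/-- The index of the interval `[X k, X (k + 1))` that contains `m`. -/
noncomputable def intervalIndex (X : ℤ → ℤ) (m : ℤ) : ℤ :=
  open Classical in if h : ∃ k, X k ≤ m ∧ m < X (k + 1) then h.choose else 0

theorem intervalIndex_spec {X : ℤ → ℤ} (hX : StrictMono X) (m : ℤ) :
    X (intervalIndex X m) ≤ m ∧ m < X (intervalIndex X m + 1) := by
  have h := hX.exists_int_index m
  rw [intervalIndex, dif_pos h]
  exact h.choose_spec

theorem intervalIndex_eq {X : ℤ → ℤ} (hX : StrictMono X) {m k : ℤ}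
    (hk : X k ≤ m) (hk' : m < X (k + 1)) : intervalIndex X m = k :=
  hX.int_index_unique (intervalIndex_spec hX m).1 (intervalIndex_spec hX m).2 hk hk'

/-- The sums of consecutive values of `a`, starting at `0`. -/
def partialSum (a : ℤ → ℤ) : ℤ → ℤ
  | Int.ofNat n => ∑ i ∈ Finset.range n, a i
  | Int.negSucc n => -∑ i ∈ Finset.range (n + 1), a (-(i : ℤ) - 1)

theorem partialSum_zero (a : ℤ → ℤ) : partialSum a 0 = 0 := by
  show partialSum a (Int.ofNat 0) = 0
  simp [partialSum]

theorem partialSum_succ (a : ℤ → ℤ) (k : ℤ) : partialSum a (k + 1) = partialSum a k + a k := by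
  obtain n | n := k
  · show partialSum a (Int.ofNat (n + 1)) = _
    simp [partialSum, Finset.sum_range_succ]
  · obtain _ | n := n
    · show partialSum a (Int.ofNat 0) = partialSum a (Int.negSucc 0) + a (Int.negSucc 0)
      simp only [partialSum, Finset.range_zero, Finset.sum_empty, zero_add, Finset.sum_range_one]
      have : (Int.negSucc 0) = -((0 : ℕ) : ℤ) - 1 := rfl
      rw [this]; ring
    · have e : Int.negSucc (n + 1) + 1 = Int.negSucc n := by omega
      rw [e]
      simp only [partialSum]
      rw [Finset.sum_range_succ _ (n + 1)]
      have : (Int.negSucc (n + 1)) = -((n + 1 : ℕ) : ℤ) - 1 := by omega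
      rw [this]; ring

theorem partialSum_strictMono {a : ℤ → ℤ} (ha : ∀ k, 0 < a k) : StrictMono (partialSum a) :=
  strictMono_int_of_lt_succ fun k => by rw [partialSum_succ]; linarith [ha k]

/-- A set of integers in which gaps are bounded can be enumerated by `ℤ` in increasing order. -/
theorem exists_int_enumeration {C : ℤ → Prop} (hC : ∀ i, C i ∨ C (i + 1) ∨ C (i + 2)) :
    ∃ X : ℤ → ℤ, StrictMono X ∧ (∀ k, C (X k)) ∧ ∀ i, C i → ∃ k, X k = i := by
  classical
  have hn : Nonempty {i // C i} := by
    obtain h | h | h := hC 0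
    exacts [⟨_, h⟩, ⟨_, h⟩, ⟨_, h⟩]
  -- Bounded gaps serve to exclude extreme elements; a subset of `ℤ` without extremes is order
  -- isomorphic to `ℤ`.
  have : NoMaxOrder {i // C i} := ⟨fun a => by
    obtain h | h | h := hC (a.1 + 1)
    · exact ⟨⟨_, h⟩, by rw [← Subtype.coe_lt_coe]; show a.1 < a.1 + 1; omega⟩
    · exact ⟨⟨_, h⟩, by rw [← Subtype.coe_lt_coe]; show a.1 < a.1 + 1 + 1; omega⟩
    · exact ⟨⟨_, h⟩, by rw [← Subtype.coe_lt_coe]; show a.1 < a.1 + 1 + 2; omega⟩⟩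
  have : NoMinOrder {i // C i} := ⟨fun a => by
    -- Starting three below `a` puts all three candidates below `a`.
    obtain h | h | h := hC (a.1 - 3)
    · exact ⟨⟨_, h⟩, by rw [← Subtype.coe_lt_coe]; show a.1 - 3 < a.1; omega⟩
    · exact ⟨⟨_, h⟩, by rw [← Subtype.coe_lt_coe]; show a.1 - 3 + 1 < a.1; omega⟩
    · exact ⟨⟨_, h⟩, by rw [← Subtype.coe_lt_coe]; show a.1 - 3 + 2 < a.1; omega⟩⟩
  let _ : SuccOrder {i // C i} := LinearLocallyFiniteOrder.succOrder _
  let _ : PredOrder {i // C i} := LinearLocallyFiniteOrder.predOrder _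
  let e : {i // C i} ≃o ℤ := orderIsoIntOfLinearSuccPredArch
  exact ⟨fun k => (e.symm k).1, fun _ _ h => e.symm.strictMono h, fun k => (e.symm k).2,
    fun i hi => ⟨e ⟨i, hi⟩, by simp⟩⟩

theorem next_of_int_enumeration {C : ℤ → Prop} {X : ℤ → ℤ} (hX : StrictMono X)
    (hXC : ∀ k, C (X k)) (hCX : ∀ i, C i → ∃ k, X k = i) {k m : ℤ} (hm : C m) (hkm : X k < m)
    (hbetween : ∀ i, X k < i → i < m → ¬ C i) : X (k + 1) = m := by
  obtain ⟨l, rfl⟩ := hCX m hm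
  have hkl : k < l := hX.lt_iff_lt.1 hkm
  by_contra h
  have hlt : X (k + 1) < X l := lt_of_le_of_ne (hX.monotone (by omega)) h
  exact hbetween _ (hX (by omega)) hlt (hXC _)

/-! ### Patterns of shape `(2, 2)` in the tilings by `𝒰` -/

/-- The letters of a pattern of shape `(2, 2)`: lower left, lower right, upper left, upper right. -/
abbrev Quad := Fin 19 × Fin 19 × Fin 19 × Fin 19

/-- The pattern of shape `(2, 2)` of `w` with lower left corner `n`. -/
def quadAt (w : ℤ × ℤ → Fin 19) (n : ℤ × ℤ) : Quad :=
  (w n, w (n + (1, 0)), w (n + (0, 1)), w (n + (1, 1)))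

/-- The right half of `q` is the left half of `r`. -/
def Quad.adjRight (q r : Quad) : Bool := q.2.1 == r.1 && q.2.2.2 == r.2.2.1

/-- The upper half of `q` is the lower half of `r`. -/
def Quad.adjUp (q r : Quad) : Bool := q.2.2.1 == r.1 && q.2.2.2 == r.2.1

theorem quadAt_adjRight (w : ℤ × ℤ → Fin 19) (n : ℤ × ℤ) :
    (quadAt w n).adjRight (quadAt w (n + (1, 0))) = true := by
  simp [Quad.adjRight, quadAt, add_assoc]

theorem quadAt_adjUp (w : ℤ × ℤ → Fin 19) (n : ℤ × ℤ) :
    (quadAt w n).adjUp (quadAt w (n + (0, 1))) = true := by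
  simp [Quad.adjUp, quadAt, add_assoc]

/-- `q` has in `S` neighbors to the left, to the right, above, below, above on the left. -/
def Quad.survives (S : List Quad) (q : Quad) : Bool :=
  S.any (fun r => q.adjRight r) && S.any (fun d => d.adjUp q) &&
    S.any fun l => l.adjRight q && S.any fun u => q.adjUp u &&
      S.any fun c => l.adjUp c && c.adjRight u

/-- Soundness of one round of pruning: the neighbors demanded by `Quad.survives` are supplied by the
tiling itself. -/
theorem quadAt_mem_filter_survives {w : ℤ × ℤ → Fin 19} {S : List Quad}
    (h : ∀ n, quadAt w n ∈ S) (n : ℤ × ℤ) : quadAt w n ∈ S.filter (Quad.survives S) := by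
  have e : n + (-1, 0) + (1, 0) = n := by ext <;> simp
  have e' : n + (0, -1) + (0, 1) = n := by ext <;> simp
  have e'' : n + (-1, 0) + (0, 1) + (1, 0) = n + (0, 1) := by ext <;> simp
  have h1 := quadAt_adjRight w (n + (-1, 0))
  have h2 := quadAt_adjUp w (n + (0, -1))
  have h3 := quadAt_adjRight w (n + (-1, 0) + (0, 1))
  rw [e] at h1; rw [e'] at h2; rw [e''] at h3
  simp only [List.mem_filter, Quad.survives, Bool.and_eq_true, List.any_eq_true]
  exact ⟨h n, ⟨⟨_, h _, quadAt_adjRight w n⟩, ⟨_, h _, h2⟩⟩, _, h (n + (-1, 0)), h1, _, h _,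
    quadAt_adjUp w n, _, h _, quadAt_adjUp w _, h3⟩

/-- The patterns of shape `(2, 2)` in which adjacent tiles match. -/
def matchingQuads : List Quad :=
  (List.finRange 19).flatMap fun a =>
    ((List.finRange 19).filter fun b => (tilesU a).right = (tilesU b).left).flatMap fun b =>
      ((List.finRange 19).filter fun c => (tilesU a).top = (tilesU c).bottom).flatMap fun c =>
        ((List.finRange 19).filter fun d =>
          (tilesU c).right = (tilesU d).left ∧ (tilesU b).top = (tilesU d).bottom).map
          fun d => (a, b, c, d)

/-- The patterns of shape `(2, 2)` that appear in the tilings by `𝒰`. -/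
def quads : List Quad :=
  [(0, 3, 8, 16), (1, 2, 8, 16), (1, 3, 8, 16), (1, 6, 9, 14), (1, 6, 11, 17), (2, 0, 16, 8),
    (2, 4, 16, 13), (3, 7, 16, 15), (4, 1, 13, 9), (5, 1, 13, 9), (6, 1, 14, 8), (6, 1, 14, 11),
    (6, 1, 17, 8), (6, 5, 14, 13), (6, 5, 17, 13), (7, 1, 15, 8), (7, 1, 15, 11), (8, 16, 0, 3),
    (8, 16, 9, 14), (8, 16, 11, 17), (9, 14, 1, 2), (9, 14, 1, 6), (9, 14, 10, 12),
    (10, 12, 1, 6), (10, 14, 1, 6), (11, 17, 1, 3), (11, 17, 10, 14), (12, 9, 6, 1),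
    (13, 9, 4, 1), (13, 9, 7, 1), (13, 9, 18, 10), (14, 8, 2, 0), (14, 8, 12, 9), (14, 11, 6, 1),
    (14, 13, 2, 4), (14, 18, 6, 5), (15, 8, 13, 9), (15, 11, 7, 1), (15, 11, 18, 10),
    (16, 8, 14, 11), (16, 13, 3, 7), (16, 13, 14, 18), (16, 15, 3, 7), (16, 15, 14, 13),
    (16, 15, 14, 18), (16, 15, 17, 13), (17, 8, 14, 11), (17, 13, 3, 7), (17, 13, 14, 18),
    (18, 10, 5, 1)]

theorem quadAt_mem_matchingQuads {w : ℤ × ℤ → Fin 19} (hw : w ∈ wangShift tilesU) (n : ℤ × ℤ) :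
    quadAt w n ∈ matchingQuads := by
  have h1 := (hw (n + (0, 1))).1
  have h2 := (hw (n + (1, 0))).2
  have e : n + (0, 1) + (1, 0) = n + (1, 1) := by ext <;> simp
  have e' : n + (1, 0) + (0, 1) = n + (1, 1) := by ext <;> simp
  rw [e] at h1; rw [e'] at h2
  simp only [matchingQuads, List.mem_flatMap, List.mem_filter, List.mem_finRange, List.mem_map,
    true_and, decide_eq_true_eq, quadAt, Prod.mk.injEq]
  exact ⟨_, _, (hw n).1, _, (hw n).2, _, ⟨h1, h2⟩, rfl, rfl, rfl, rfl⟩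

def pruneStep (S : List Quad) : List Quad := S.filter (Quad.survives S)

/-- Only an upper bound on the patterns is needed here; that all of them occur follows later, from
`isRecurrent_of_mem_quads`. -/
theorem pruned_subset_quads : pruneStep (pruneStep (pruneStep matchingQuads)) ⊆ quads := by
  decide +kernel

theorem quadAt_mem_quads {w : ℤ × ℤ → Fin 19} (hw : w ∈ wangShift tilesU) (n : ℤ × ℤ) :
    quadAt w n ∈ quads := by
  refine pruned_subset_quads ?_
  have step : ∀ S : List Quad, (∀ n, quadAt w n ∈ S) → ∀ n, quadAt w n ∈ pruneStep S :=
    fun S h n => quadAt_mem_filter_survives h n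
  exact step _ (step _ (step _ (quadAt_mem_matchingQuads hw))) n

/-- The rows of a tiling consist of tiles of the same kind. -/
def isShort (t : Fin 19) : Bool := Nat.blt t 8

/-- The columns of a tiling consist of tiles of the same kind. -/
def isNarrow (t : Fin 19) : Bool := Nat.blt t 2 || (Nat.ble 8 t && Nat.blt t 12)

theorem int_const_of_succ {α : Type*} {f : ℤ → α} (h : ∀ j, f (j + 1) = f j) (j : ℤ) :
    f j = f 0 := by
  induction j with
  | zero => rfl
  | succ n ih => rw [h, ih]
  | pred n ih => rw [← ih, ← h, sub_add_cancel]

theorem quads_kinds : quads.all (fun q => isShort q.2.1 == isShort q.1 &&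
    isNarrow q.2.2.1 == isNarrow q.1 && (!isShort q.1 || !isShort q.2.2.1) &&
    (!isNarrow q.1 || !isNarrow q.2.1)) = true := by
  decide +kernel

theorem quads_runs : quads.all (fun q => quads.all fun r =>
    !q.adjRight r || isNarrow q.1 || isNarrow q.2.1 || isNarrow r.2.1) = true := by
  decide +kernel

/-- The patterns of shape `(2, 3)` without short tiles. -/
def tallPairs : List (Quad × Quad) :=
  quads.flatMap fun q => (quads.filter fun u => q.adjUp u && !isShort q.1 && !isShort q.2.2.1 &&
    !isShort u.2.2.1).map fun u => (q, u)

/-- The pairs in `S` that have a left neighbor in `S`. -/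
def pairStep (S : List (Quad × Quad)) : List (Quad × Quad) :=
  S.filter fun p => S.any fun p' => p'.1.adjRight p.1 && p'.2.adjRight p.2

/-- A row of such pairs, infinite to the left, would survive every round of deletion, so there is
none. -/
theorem tallPairs_pruned :
    pairStep (pairStep (pairStep (pairStep (pairStep tallPairs)))) = [] := by
  decide +kernel

/-! ### Short rows and narrow columns of a tiling. -/

section

variable {w : ℤ × ℤ → Fin 19} (hw : w ∈ wangShift tilesU)

include hw

theorem quadAt_kinds (n : ℤ × ℤ) : isShort (w (n + (1, 0))) = isShort (w n) ∧
    isNarrow (w (n + (0, 1))) = isNarrow (w n) ∧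
    (isShort (w n) → isShort (w (n + (0, 1))) = false) ∧
    (isNarrow (w n) → isNarrow (w (n + (1, 0))) = false) := by
  have := List.all_eq_true.1 quads_kinds _ (quadAt_mem_quads hw n)
  simp only [quadAt, Bool.and_eq_true, beq_iff_eq, Bool.or_eq_true, Bool.not_eq_true'] at this
  grind

theorem isShort_row (i j : ℤ) : isShort (w (i, j)) = isShort (w (0, j)) :=
  int_const_of_succ (f := fun i => isShort (w (i, j)))
    (fun i => by simpa using (quadAt_kinds hw (i, j)).1) i

theorem isNarrow_column (i j : ℤ) : isNarrow (w (i, j)) = isNarrow (w (i, 0)) :=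
  int_const_of_succ (f := fun j => isNarrow (w (i, j)))
    (fun j => by simpa using (quadAt_kinds hw (i, j)).2.1) j

theorem not_isShort_succ (i j : ℤ) (h : isShort (w (i, j))) : isShort (w (i, j + 1)) = false := by
  simpa using (quadAt_kinds hw (i, j)).2.2.1 h

theorem not_isNarrow_succ (i j : ℤ) (h : isNarrow (w (i, j))) :
    isNarrow (w (i + 1, j)) = false := by
  simpa using (quadAt_kinds hw (i, j)).2.2.2 h

theorem exists_isShort (i j : ℤ) :
    isShort (w (i, j)) ∨ isShort (w (i, j + 1)) ∨ isShort (w (i, j + 2)) := by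
  by_contra! h
  simp only [ne_eq, Bool.not_eq_true] at h
  -- In a strip of three tall rows each pair has its left neighbor in the strip, so no round deletes
  -- any of them.
  have step : ∀ S : List (Quad × Quad),
      (∀ i, (quadAt w (i, j), quadAt w ((i, j) + (0, 1))) ∈ S) →
      ∀ i, (quadAt w (i, j), quadAt w ((i, j) + (0, 1))) ∈ pairStep S := by
    intro S hS i
    refine List.mem_filter.2 ⟨hS i, List.any_eq_true.2 ⟨_, hS (i - 1), ?_⟩⟩
    have h1 := quadAt_adjRight w (i - 1, j)
    have h2 := quadAt_adjRight w (i - 1, j + 1)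
    simp only [Prod.mk_add_mk, sub_add_cancel, add_zero] at h1 h2 ⊢
    rw [h1, h2]; rfl
  have base : ∀ i, (quadAt w (i, j), quadAt w ((i, j) + (0, 1))) ∈ tallPairs := by
    intro i'
    refine List.mem_flatMap.2 ⟨_, quadAt_mem_quads hw _, List.mem_map.2 ⟨_, List.mem_filter.2
      ⟨quadAt_mem_quads hw _, ?_⟩, rfl⟩⟩
    rw [quadAt_adjUp]
    rw [isShort_row hw i, isShort_row hw i, isShort_row hw i] at h
    simp [quadAt, add_assoc, isShort_row hw i', h]
  have := step _ (step _ (step _ (step _ (step _ base)))) i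
  rw [tallPairs_pruned] at this
  exact List.not_mem_nil this

theorem exists_isNarrow (i j : ℤ) :
    isNarrow (w (i, j)) ∨ isNarrow (w (i + 1, j)) ∨ isNarrow (w (i + 2, j)) := by
  have := List.all_eq_true.1 (List.all_eq_true.1 quads_runs _ (quadAt_mem_quads hw (i, j))) _
    (quadAt_mem_quads hw ((i, j) + (1, 0)))
  rw [quadAt_adjRight] at this
  simp only [quadAt, Bool.or_eq_true] at this
  simpa [add_assoc, or_assoc] using this

end

/-! ### The morphism -/

/-- The columns, from left to right, of the images of the letters under the morphism. -/
def substColumns : List (List (List (Fin 19))) :=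
  [[[4, 13], [1, 9]], [[5, 13], [1, 9]], [[6, 14], [1, 8], [2, 16]], [[6, 14], [1, 8], [3, 16]],
    [[4, 13], [1, 9], [6, 14]], [[5, 13], [1, 9], [6, 14]], [[6, 14], [1, 11], [6, 17]],
    [[7, 15], [1, 11], [6, 17]], [[7, 15, 13], [1, 8, 9]], [[4, 13, 18], [1, 9, 10]],
    [[5, 13, 18], [1, 9, 10]], [[7, 15, 18], [1, 11, 10]], [[6, 14, 12], [1, 8, 9], [2, 16, 14]],
    [[7, 15, 13], [1, 8, 9], [2, 16, 14]], [[6, 14, 12], [1, 8, 9], [3, 16, 14]],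
    [[7, 15, 13], [1, 8, 9], [3, 16, 14]], [[2, 16, 14], [0, 8, 11], [3, 16, 17]],
    [[6, 17, 14], [1, 8, 11], [3, 16, 17]], [[7, 15, 18], [1, 11, 10], [6, 17, 14]]]

/-- The letter in column `a` and row `b` of the image of `t`. -/
def substLetter (t : Fin 19) (a b : ℕ) : Fin 19 :=
  ((substColumns.getD t []).getD a []).getD b 0

def substWidth (t : Fin 19) : ℕ := if isNarrow t then 2 else 3

def substHeight (t : Fin 19) : ℕ := if isShort t then 2 else 3

theorem two_le_substWidth (t : Fin 19) : 2 ≤ substWidth t := by unfold substWidth; split <;> omega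
theorem substWidth_le (t : Fin 19) : substWidth t ≤ 3 := by unfold substWidth; split <;> omega
theorem two_le_substHeight (t : Fin 19) : 2 ≤ substHeight t := by
  unfold substHeight; split <;> omega
theorem substHeight_le (t : Fin 19) : substHeight t ≤ 3 := by unfold substHeight; split <;> omega

/-- `w` is the concatenation of the images of the letters of `z`; the image of `z (i, j)` has its
lower left corner at `(X i, Y j)`. -/
def IsSubst (z w : ℤ × ℤ → Fin 19) (X Y : ℤ → ℤ) : Prop :=
  ∀ i j : ℤ, X (i + 1) = X i + substWidth (z (i, j)) ∧ Y (j + 1) = Y j + substHeight (z (i, j)) ∧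
    ∀ a b : ℕ, a < substWidth (z (i, j)) → b < substHeight (z (i, j)) →
      w (X i + a, Y j + b) = substLetter (z (i, j)) a b

/-- The pattern of shape `(3, 3)` composed of four overlapping patterns of shape `(2, 2)`. -/
def windowLetter (q r u c : Quad) : ℕ → ℕ → Fin 19
  | 0, 0 => q.1 | 1, 0 => q.2.1 | 2, 0 => r.2.1
  | 0, 1 => q.2.2.1 | 1, 1 => q.2.2.2 | 2, 1 => r.2.2.2
  | 0, 2 => u.2.2.1 | 1, 2 => u.2.2.2 | 2, 2 => c.2.2.2
  | _, _ => 0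

/-- The lower left corners of the images of letters. -/
def Quad.isCorner (q : Quad) : Bool := isShort q.1 && isNarrow q.2.1

/-- The pattern with letters `f a b` starts with the image of `t`, followed by the image of a letter
on the right and above. -/
def isImageOf (f : ℕ → ℕ → Fin 19) (t : Fin 19) : Bool :=
  (List.range (substWidth t)).all fun a => (List.range (substHeight t)).all fun b =>
    f a b == substLetter t a b

/-- The list of all horizontal triples of patterns that can appear below `p`. -/
def triplesBelow (p : Quad × Quad × Quad) : List (Quad × Quad × Quad) :=
  (quads.filter fun a => a.adjUp p.1).flatMap fun a =>
    (quads.filter fun b => b.adjUp p.2.1 && a.adjRight b).flatMap fun b =>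
      (quads.filter fun c => c.adjUp p.2.2 && b.adjRight c).map fun c => (a, b, c)

/-- The patterns `q`, `r`, `u`, `c` form the 3 × 3 window at a corner; `r'` adds the column that
decides whether the block is 2 or 3 wide. Locally consistent windows that are not images are
discarded, either for lack of two rows of patterns below or for lack of `c'`. -/
theorem exists_preimage_letter : quads.all (fun q => !q.isCorner || quads.all fun r =>
    !q.adjRight r || quads.all fun u => !q.adjUp u || quads.all fun c =>
    !(r.adjUp c && u.adjRight c) || quads.all fun r' => !r.adjRight r' ||
    ((triplesBelow (q, r, r')).flatMap triplesBelow).isEmpty || quads.all fun c' =>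
    !(r'.adjUp c' && c.adjRight c') ||
    (List.finRange 19).any fun t => isNarrow t == isNarrow r'.2.1 && isShort t == isShort u.2.2.1 &&
      isImageOf (windowLetter q r u c) t) = true := by
  decide +kernel

/-- This makes the blocks visible in an image: they start one column before the narrow columns, at
the short rows. -/
theorem substLetter_kinds {t : Fin 19} {a b : ℕ} (ha : a < substWidth t) (hb : b < substHeight t) :
    (isNarrow (substLetter t a b) ↔ a = 1) ∧ (isShort (substLetter t a b) ↔ b = 0) := by
  have : ∀ t, ∀ a < substWidth t, ∀ b < substHeight t,
      (isNarrow (substLetter t a b) ↔ a = 1) ∧ (isShort (substLetter t a b) ↔ b = 0) := by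
    decide +kernel
  exact this t a ha b hb

theorem substLetter_injective : ∀ t t', substWidth t = substWidth t' →
    substHeight t = substHeight t' →
    (∀ a < substWidth t, ∀ b < substHeight t, substLetter t a b = substLetter t' a b) →
    t = t' := by
  decide +kernel

theorem substLetter_inner : ∀ t, ∀ a < substWidth t, ∀ b < substHeight t,
    (a + 1 < substWidth t →
      (tilesU (substLetter t a b)).right = (tilesU (substLetter t (a + 1) b)).left) ∧
    (b + 1 < substHeight t →
      (tilesU (substLetter t a b)).top = (tilesU (substLetter t a (b + 1))).bottom) := by
  decide +kernel

/-- The side of a block carries the same information as the color of the letter, so validity passes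
from letters to images and back. -/
theorem right_eq_left_iff : ∀ t t', substHeight t = substHeight t' →
    ((tilesU t).right = (tilesU t').left ↔ ∀ b < substHeight t,
      (tilesU (substLetter t (substWidth t - 1) b)).right =
        (tilesU (substLetter t' 0 b)).left) := by
  decide +kernel

theorem top_eq_bottom_iff : ∀ t t', substWidth t = substWidth t' →
    ((tilesU t).top = (tilesU t').bottom ↔ ∀ a < substWidth t,
      (tilesU (substLetter t a (substHeight t - 1))).top =
        (tilesU (substLetter t' a 0)).bottom) := by
  decide +kernel

/-- Matching colors force compatible block sizes, so that the images of the letters of a tiling can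
be concatenated. -/
theorem substHeight_eq_of_match : ∀ t t', (tilesU t).right = (tilesU t').left →
    substHeight t = substHeight t' := by
  decide +kernel

theorem substWidth_eq_of_match : ∀ t t', (tilesU t).top = (tilesU t').bottom →
    substWidth t = substWidth t' := by
  decide +kernel

/-! ### Desubstitution of tilings. -/

section

variable {w : ℤ × ℤ → Fin 19} (hw : w ∈ wangShift tilesU)

include hw

theorem mem_triplesBelow (n : ℤ × ℤ) :
    (quadAt w n, quadAt w (n + (1, 0)), quadAt w (n + (1, 0) + (1, 0))) ∈
      triplesBelow (quadAt w (n + (0, 1)), quadAt w (n + (0, 1) + (1, 0)),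
        quadAt w (n + (0, 1) + (1, 0) + (1, 0))) := by
  have e : ∀ n : ℤ × ℤ, n + (0, 1) + (1, 0) = n + (1, 0) + (0, 1) := fun n => add_right_comm _ _ _
  simp only [triplesBelow, List.mem_flatMap, List.mem_filter, List.mem_map, Bool.and_eq_true, e,
    Prod.mk.injEq]
  exact ⟨_, ⟨quadAt_mem_quads hw _, quadAt_adjUp w _⟩, _,
    ⟨quadAt_mem_quads hw _, quadAt_adjUp w _, quadAt_adjRight w _⟩, _,
    ⟨quadAt_mem_quads hw _, quadAt_adjUp w _, quadAt_adjRight w _⟩, rfl, rfl, rfl⟩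

/-- Column `x + 3` and row `y + 2` are where the next narrow column and the next short row lie if
the block has width, respectively height, 2. -/
theorem exists_image_at {x y : ℤ} (hx : isNarrow (w (x + 1, y))) (hy : isShort (w (x, y))) :
    ∃ t, isNarrow t = isNarrow (w (x + 3, y)) ∧ isShort t = isShort (w (x, y + 2)) ∧
      ∀ a b : ℕ, a < substWidth t → b < substHeight t →
        w (x + a, y + b) = substLetter t a b := by
  set n : ℤ × ℤ := (x, y) with hn
  have e : n + (0, 1) + (1, 0) = n + (1, 0) + (0, 1) := add_right_comm _ _ _
  have hq := List.all_eq_true.1 exists_preimage_letter _ (quadAt_mem_quads hw n)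
  have hc : (quadAt w n).isCorner = true := by
    simp only [Quad.isCorner, quadAt, Bool.and_eq_true]
    exact ⟨hy, by simpa [hn] using hx⟩
  rw [hc, Bool.not_true, Bool.false_or] at hq
  have hr := List.all_eq_true.1 hq _ (quadAt_mem_quads hw (n + (1, 0)))
  rw [quadAt_adjRight, Bool.not_true, Bool.false_or] at hr
  have hu := List.all_eq_true.1 hr _ (quadAt_mem_quads hw (n + (0, 1)))
  rw [quadAt_adjUp, Bool.not_true, Bool.false_or] at hu
  have hcc := List.all_eq_true.1 hu _ (quadAt_mem_quads hw (n + (1, 0) + (0, 1)))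
  have h1 := quadAt_adjRight w (n + (0, 1))
  rw [e] at h1
  rw [quadAt_adjUp, h1, Bool.and_true, Bool.not_true, Bool.false_or] at hcc
  have hr' := List.all_eq_true.1 hcc _ (quadAt_mem_quads hw (n + (1, 0) + (1, 0)))
  rw [quadAt_adjRight, Bool.not_true, Bool.false_or, Bool.or_eq_true] at hr'
  obtain hE | hr' := hr'
  -- The two rows of `w` below the window contradict this alternative.
  · rw [List.isEmpty_iff] at hE
    have k1 := mem_triplesBelow hw (n + (0, -1))
    have k2 := mem_triplesBelow hw (n + (0, -1) + (0, -1))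
    have e1 : ∀ n : ℤ × ℤ, n + (0, -1) + (0, 1) = n := fun n => by ext <;> simp
    rw [e1] at k1 k2
    have := List.mem_flatMap.2 ⟨_, k1, k2⟩
    rw [hE] at this
    exact absurd this List.not_mem_nil
  have hc' := List.all_eq_true.1 hr' _ (quadAt_mem_quads hw (n + (1, 0) + (1, 0) + (0, 1)))
  have h2 := quadAt_adjRight w (n + (1, 0) + (0, 1))
  rw [show n + (1, 0) + (0, 1) + (1, 0) = n + (1, 0) + (1, 0) + (0, 1) from
    add_right_comm _ _ _] at h2
  rw [quadAt_adjUp, h2, Bool.and_true, Bool.not_true, Bool.false_or, List.any_eq_true] at hc'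
  obtain ⟨t, -, ht⟩ := hc'
  simp only [Bool.and_eq_true, beq_iff_eq] at ht
  obtain ⟨⟨ht1, ht2⟩, ht3⟩ := ht
  refine ⟨t, ?_, ?_, fun a b ha hb => ?_⟩
  · simpa [quadAt, hn, add_assoc] using ht1
  · simpa [quadAt, hn, add_assoc] using ht2
  · simp only [isImageOf, List.all_eq_true, List.mem_range, beq_iff_eq] at ht3
    rw [← ht3 a ha b hb]
    have := substWidth_le t
    have := substHeight_le t
    have ha' : a < 3 := by omega
    have hb' : b < 3 := by omega
    clear ht3 ha hb
    interval_cases a <;> interval_cases b <;> simp [windowLetter, quadAt, hn, add_assoc]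

/-- Every tiling is, up to a shift, the image of a tiling. -/
theorem exists_desubstitution :
    ∃ z ∈ wangShift tilesU, ∃ X Y : ℤ → ℤ, StrictMono X ∧ StrictMono Y ∧ IsSubst z w X Y := by
  -- Cuts are put one column before each narrow column, since narrow tiles sit in the second column
  -- of a block.
  obtain ⟨X, hX, hXC, hCX⟩ := exists_int_enumeration (C := fun i => isNarrow (w (i + 1, 0)))
    (fun i => by
      have := exists_isNarrow hw (i + 1) 0
      rwa [add_right_comm, add_right_comm i 1 2] at this)
  obtain ⟨Y, hY, hYC, hCY⟩ := exists_int_enumeration (C := fun j => isShort (w (0, j)))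
    (exists_isShort hw 0)
  have hz : ∀ i j, ∃ t, isNarrow t = isNarrow (w (X i + 3, Y j)) ∧
      isShort t = isShort (w (X i, Y j + 2)) ∧
      ∀ a b : ℕ, a < substWidth t → b < substHeight t →
        w (X i + a, Y j + b) = substLetter t a b := fun i j =>
    exists_image_at hw (by rw [isNarrow_column hw]; exact hXC i)
      (by rw [isShort_row hw]; exact hYC j)
  choose t ht1 ht2 ht3 using hz
  -- The narrow column after `X i + 1` is `X i + 3` or `X i + 4`; the kind of `t i j` says which.
  have hXs : ∀ i j, X (i + 1) = X i + substWidth (t i j) := by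
    intro i j
    have h1 := not_isNarrow_succ hw (X i + 1) 0 (hXC i)
    have h3 := exists_isNarrow hw (X i + 2) 0
    rw [add_assoc] at h1
    rw [substWidth, ht1, isNarrow_column hw]
    by_cases h : isNarrow (w (X i + 3, 0))
    · rw [if_pos h]
      refine next_of_int_enumeration hX hXC hCX (by simpa [add_assoc] using h) (by simp) ?_
      intro m hm hm'
      obtain rfl : m = X i + 1 := by push_cast at hm'; omega
      simpa [add_assoc] using h1
    · rw [if_neg h]
      refine next_of_int_enumeration hX hXC hCX ?_ (by simp) ?_
      · simp only [add_assoc] at h3 ⊢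
        norm_num at h3 h h1 ⊢
        simpa [h, h1] using h3
      · intro m hm hm'
        obtain rfl | rfl : m = X i + 1 ∨ m = X i + 2 := by push_cast at hm'; omega
        · simpa [add_assoc] using h1
        · simpa [add_assoc] using h
  have hYs : ∀ i j, Y (j + 1) = Y j + substHeight (t i j) := by
    intro i j
    have h1 := not_isShort_succ hw 0 (Y j) (hYC j)
    have h3 := exists_isShort hw 0 (Y j + 1)
    rw [substHeight, ht2, isShort_row hw]
    by_cases h : isShort (w (0, Y j + 2))
    · rw [if_pos h]
      refine next_of_int_enumeration hY hYC hCY (by simpa using h) (by simp) ?_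
      intro m hm hm'
      obtain rfl : m = Y j + 1 := by push_cast at hm'; omega
      simpa using h1
    · rw [if_neg h]
      refine next_of_int_enumeration hY hYC hCY ?_ (by simp) ?_
      · simp only [add_assoc] at h3 ⊢
        norm_num at h3 h h1 ⊢
        simpa [h, h1] using h3
      · intro m hm hm'
        obtain rfl | rfl : m = Y j + 1 ∨ m = Y j + 2 := by push_cast at hm'; omega
        · simpa using h1
        · simpa using h
  refine ⟨fun n => t n.1 n.2, fun n => ?_, X, Y, hX, hY, fun i j => ⟨hXs i j, hYs i j, ht3 i j⟩⟩
  obtain ⟨i, j⟩ := n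
  simp only [Prod.mk_add_mk, add_zero]
  have two := two_le_substWidth (t i j)
  have two' := two_le_substHeight (t i j)
  constructor
  -- The letters match because the facing sides of their blocks are adjacent in `w`.
  · have hH : substHeight (t i j) = substHeight (t (i + 1) j) := by
      have := hYs i j; have := hYs (i + 1) j; omega
    refine (right_eq_left_iff _ _ hH).2 fun b hb => ?_
    rw [← ht3 i j _ b (by omega) hb, ← ht3 (i + 1) j 0 b (by linarith [two_le_substWidth (t (i + 1) j)])
      (hH ▸ hb)]
    convert (hw _).1 using 4
    rw [hXs i j, Prod.mk_add_mk, add_zero, Nat.cast_zero, add_zero, Nat.cast_sub (by omega)]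
    congr 1
    push_cast; ring
  · have hW : substWidth (t i j) = substWidth (t i (j + 1)) := by
      have := hXs i j; have := hXs i (j + 1); omega
    refine (top_eq_bottom_iff _ _ hW).2 fun a ha => ?_
    rw [← ht3 i j a _ ha (by omega), ← ht3 i (j + 1) a 0 (hW ▸ ha)
      (by linarith [two_le_substHeight (t i (j + 1))])]
    convert (hw _).2 using 4
    rw [hYs i j, Prod.mk_add_mk, add_zero, Nat.cast_zero, add_zero, Nat.cast_sub (by omega)]
    congr 1
    push_cast; ring

end

/-! ### Images of tilings -/

/-- The morphism of which the set of tilings by `𝒰` is a fixed point. -/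
def subst (t : Fin 19) : Word2 (Fin 19) :=
  ⟨substWidth t, substHeight t, fun a b => substLetter t a b⟩

theorem isImageConfig_subst_iff {z w : ℤ × ℤ → Fin 19} :
    IsImageConfig subst z w ↔ ∃ X Y : ℤ → ℤ, X 0 = 0 ∧ Y 0 = 0 ∧ IsSubst z w X Y := by
  constructor
  · rintro ⟨X, Y, hX, hY, h⟩
    exact ⟨X, Y, hX, hY, fun i j => ⟨(h i j).1, (h i j).2.1,
      fun a b ha hb => (h i j).2.2 ⟨a, ha⟩ ⟨b, hb⟩⟩⟩
  · rintro ⟨X, Y, hX, hY, h⟩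
    exact ⟨X, Y, hX, hY, fun i j => ⟨(h i j).1, (h i j).2.1,
      fun a b => (h i j).2.2 a b a.2 b.2⟩⟩

namespace IsSubst

variable {z w : ℤ × ℤ → Fin 19} {X Y : ℤ → ℤ} (h : IsSubst z w X Y)

include h

theorem strictMono_left : StrictMono X :=
  strictMono_int_of_lt_succ fun i => by
    have := (h i 0).1; have := two_le_substWidth (z (i, 0)); omega

theorem strictMono_right : StrictMono Y :=
  strictMono_int_of_lt_succ fun j => by
    have := (h 0 j).2.1; have := two_le_substHeight (z (0, j)); omega

theorem exists_coord (p q : ℤ) : ∃ (i j : ℤ) (a b : ℕ), a < substWidth (z (i, j)) ∧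
    b < substHeight (z (i, j)) ∧ p = X i + a ∧ q = Y j + b := by
  obtain ⟨i, hi, hi'⟩ := h.strictMono_left.exists_int_index p
  obtain ⟨j, hj, hj'⟩ := h.strictMono_right.exists_int_index q
  have h1 := (h i j).1
  have h2 := (h i j).2.1
  exact ⟨i, j, (p - X i).toNat, (q - Y j).toNat, by omega, by omega, by omega, by omega⟩

/-- Validity of `z` is assumed only where the cell lies on the right side of its block, so that this
also serves for configurations valid on a rectangle only. -/
theorem right_eq_left {i j : ℤ} {a b : ℕ} (ha : a < substWidth (z (i, j)))
    (hb : b < substHeight (z (i, j)))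
    (hz : a + 1 = substWidth (z (i, j)) →
      (tilesU (z (i, j))).right = (tilesU (z (i + 1, j))).left) :
    (tilesU (w (X i + a, Y j + b))).right = (tilesU (w (X i + a + 1, Y j + b))).left := by
  rw [(h i j).2.2 a b ha hb]
  by_cases hlt : a + 1 < substWidth (z (i, j))
  · rw [(substLetter_inner _ a ha b hb).1 hlt, ← (h i j).2.2 (a + 1) b hlt hb]
    push_cast; rw [add_assoc]
  · have ha' : a + 1 = substWidth (z (i, j)) := by omega
    have hH : substHeight (z (i, j)) = substHeight (z (i + 1, j)) := by
      have := (h i j).2.1; have := (h (i + 1) j).2.1; omega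
    have := (right_eq_left_iff _ _ hH).1 (hz ha') b hb
    rw [← ha', Nat.add_sub_cancel] at this
    rw [this, ← (h (i + 1) j).2.2 0 b (by have := two_le_substWidth (z (i + 1, j)); omega)
      (hH ▸ hb), (h i j).1, ← ha']
    push_cast; rw [add_zero, add_assoc]

theorem top_eq_bottom {i j : ℤ} {a b : ℕ} (ha : a < substWidth (z (i, j)))
    (hb : b < substHeight (z (i, j)))
    (hz : b + 1 = substHeight (z (i, j)) →
      (tilesU (z (i, j))).top = (tilesU (z (i, j + 1))).bottom) :
    (tilesU (w (X i + a, Y j + b))).top = (tilesU (w (X i + a, Y j + b + 1))).bottom := by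
  rw [(h i j).2.2 a b ha hb]
  by_cases hlt : b + 1 < substHeight (z (i, j))
  · rw [(substLetter_inner _ a ha b hb).2 hlt, ← (h i j).2.2 a (b + 1) ha hlt]
    push_cast; rw [add_assoc]
  · have hb' : b + 1 = substHeight (z (i, j)) := by omega
    have hW : substWidth (z (i, j)) = substWidth (z (i, j + 1)) := by
      have := (h i j).1; have := (h i (j + 1)).1; omega
    have := (top_eq_bottom_iff _ _ hW).1 (hz hb') a ha
    rw [← hb', Nat.add_sub_cancel] at this
    rw [this, ← (h i (j + 1)).2.2 a 0 (hW ▸ ha)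
      (by have := two_le_substHeight (z (i, j + 1)); omega), (h i j).2.1, ← hb']
    push_cast; rw [add_zero, add_assoc]

theorem mem_wangShift (hz : z ∈ wangShift tilesU) : w ∈ wangShift tilesU := by
  rintro ⟨p, q⟩
  obtain ⟨i, j, a, b, ha, hb, rfl, rfl⟩ := h.exists_coord p q
  simp only [Prod.mk_add_mk, add_zero]
  exact ⟨h.right_eq_left ha hb fun _ => by simpa using (hz (i, j)).1,
    h.top_eq_bottom ha hb fun _ => by simpa using (hz (i, j)).2⟩

theorem two_mul_le_left (hX : X 0 = 0) (n : ℕ) : 2 * (n : ℤ) ≤ X n := by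
  induction n with
  | zero => simp [hX]
  | succ n ih =>
    have := (h n 0).1; have := two_le_substWidth (z (n, 0)); push_cast; omega

theorem two_mul_le_right (hY : Y 0 = 0) (n : ℕ) : 2 * (n : ℤ) ≤ Y n := by
  induction n with
  | zero => simp [hY]
  | succ n ih =>
    have := (h 0 n).2.1; have := two_le_substHeight (z (0, n)); push_cast; omega

end IsSubst

/-- Compatible sizes suffice; `z` need not be a tiling, as for the clamped extensions in
`exists_isIteratedImage`. -/
theorem exists_isSubst {z : ℤ × ℤ → Fin 19}
    (hW : ∀ i j, substWidth (z (i, j + 1)) = substWidth (z (i, j)))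
    (hH : ∀ i j, substHeight (z (i + 1, j)) = substHeight (z (i, j))) :
    ∃ (w : ℤ × ℤ → Fin 19) (X Y : ℤ → ℤ), X 0 = 0 ∧ Y 0 = 0 ∧ IsSubst z w X Y := by
  have hW' : ∀ i j, substWidth (z (i, j)) = substWidth (z (i, 0)) := fun i j =>
    int_const_of_succ (f := fun j => substWidth (z (i, j))) (hW i) j
  have hH' : ∀ i j, substHeight (z (i, j)) = substHeight (z (0, j)) := fun i j =>
    int_const_of_succ (f := fun i => substHeight (z (i, j))) (fun i => hH i j) i
  set X := partialSum fun i => (substWidth (z (i, 0)) : ℤ) with hXdef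
  set Y := partialSum fun j => (substHeight (z (0, j)) : ℤ) with hYdef
  have hX : StrictMono X := partialSum_strictMono fun i => by
    have := two_le_substWidth (z (i, 0)); omega
  have hY : StrictMono Y := partialSum_strictMono fun j => by
    have := two_le_substHeight (z (0, j)); omega
  have hXs : ∀ i j, X (i + 1) = X i + substWidth (z (i, j)) := fun i j => by
    rw [hXdef, partialSum_succ, hW' i j]
  have hYs : ∀ i j, Y (j + 1) = Y j + substHeight (z (i, j)) := fun i j => by
    rw [hYdef, partialSum_succ, hH' i j]
  refine ⟨fun m => substLetter (z (intervalIndex X m.1, intervalIndex Y m.2))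
    (m.1 - X (intervalIndex X m.1)).toNat (m.2 - Y (intervalIndex Y m.2)).toNat,
    X, Y, partialSum_zero _, partialSum_zero _, fun i j => ⟨hXs i j, hYs i j, fun a b ha hb => ?_⟩⟩
  have e1 : intervalIndex X (X i + a) = i :=
    intervalIndex_eq hX (by omega) (by rw [hXs i j]; omega)
  have e2 : intervalIndex Y (Y j + b) = j :=
    intervalIndex_eq hY (by omega) (by rw [hYs i j]; omega)
  simp [e1, e2]

theorem exists_isSubst_of_mem {z : ℤ × ℤ → Fin 19} (hz : z ∈ wangShift tilesU) :
    ∃ (w : ℤ × ℤ → Fin 19) (X Y : ℤ → ℤ), X 0 = 0 ∧ Y 0 = 0 ∧ IsSubst z w X Y :=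
  exists_isSubst (fun i j => by simpa using (substWidth_eq_of_match _ _ (hz (i, j)).2).symm)
    (fun i j => by simpa using (substHeight_eq_of_match _ _ (hz (i, j)).1).symm)

theorem shift_mem_wangShift {C ι : Type} {τ : ι → WangTile C} {x : ℤ × ℤ → ι}
    (hx : x ∈ wangShift τ) (k : ℤ × ℤ) : shift k x ∈ wangShift τ := fun n => by
  have := hx (n + k)
  simpa only [shift, add_right_comm n k] using this

/-! ### Iterated images of letters -/

/-- Adjacent letters of `f` in the rectangle `[0, p) × [0, q)` match. -/
def ValidOn (f : ℤ × ℤ → Fin 19) (p q : ℤ) : Prop :=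
  ∀ i j : ℤ, 0 ≤ i → i < p → 0 ≤ j → j < q →
    (i + 1 < p → (tilesU (f (i, j))).right = (tilesU (f (i + 1, j))).left) ∧
    (j + 1 < q → (tilesU (f (i, j))).top = (tilesU (f (i, j + 1))).bottom)

/-- Validity is part of the induction since it guarantees that the next image is defined; the side
lengths at least double each time. -/
theorem exists_isIteratedImage (a : Fin 19) (m : ℕ) : ∃ (f : ℤ × ℤ → Fin 19) (p q : ℕ),
    2 ^ m ≤ p ∧ 2 ^ m ≤ q ∧ ValidOn f p q ∧
      IsIteratedImage subst a m ⟨p, q, fun i j => f (((i : ℕ) : ℤ), ((j : ℕ) : ℤ))⟩ := by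
  induction m with
  | zero =>
    refine ⟨fun _ => a, 1, 1, by simp, by simp, ?_, rfl⟩
    intro i j _ _ _ _
    exact ⟨fun _ => by push_cast at *; omega, fun _ => by push_cast at *; omega⟩
  | succ m ih =>
    obtain ⟨f, p, q, hp, hq, hf, hit⟩ := ih
    have hp0 : 0 < p := lt_of_lt_of_le (by positivity) hp
    have hq0 : 0 < q := lt_of_lt_of_le (by positivity) hq
    -- Clamping coordinates extends the rectangle to `ℤ²`. Neighbors then either have equal letters
    -- or are neighbors in the rectangle, so block sizes stay compatible.
    set cl : ℕ → ℤ → ℤ := fun p i => max 0 (min i (p - 1)) with hcl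
    have hcl0 : ∀ p i, 0 ≤ cl p i := fun p i => le_max_left _ _
    have hcl1 : ∀ p i, 0 < p → cl p i < p := fun p i hp => by simp only [hcl]; omega
    have hcl2 : ∀ p i, cl p (i + 1) = cl p i ∨ cl p (i + 1) = cl p i + 1 ∧ cl p i + 1 < p :=
      fun p i => by simp only [hcl]; omega
    have hcl3 : ∀ (p : ℕ) (i : ℤ), 0 ≤ i → i < p → cl p i = i :=
      fun p i h0 h1 => by simp only [hcl]; omega
    set z : ℤ × ℤ → Fin 19 := fun n => f (cl p n.1, cl q n.2) with hz
    obtain ⟨w, X, Y, hX0, hY0, h⟩ := exists_isSubst (z := z)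
      (fun i j => by
        obtain e | ⟨e, hlt⟩ := hcl2 q j
        · simp only [hz, e]
        · simp only [hz, e]
          exact (substWidth_eq_of_match _ _
            ((hf _ _ (hcl0 _ _) (hcl1 _ _ hp0) (hcl0 _ _) (hcl1 _ _ hq0)).2 hlt)).symm)
      (fun i j => by
        obtain e | ⟨e, hlt⟩ := hcl2 p i
        · simp only [hz, e]
        · simp only [hz, e]
          exact (substHeight_eq_of_match _ _
            ((hf _ _ (hcl0 _ _) (hcl1 _ _ hp0) (hcl0 _ _) (hcl1 _ _ hq0)).1 hlt)).symm)
    have hXn : ∀ n : ℕ, 0 ≤ X n := fun n => by have := h.two_mul_le_left hX0 n; omega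
    have hYn : ∀ n : ℕ, 0 ≤ Y n := fun n => by have := h.two_mul_le_right hY0 n; omega
    have hzf : ∀ i j : ℤ, 0 ≤ i → i < p → 0 ≤ j → j < q → z (i, j) = f (i, j) :=
      fun i j h1 h2 h3 h4 => by simp only [hz, hcl3 p i h1 h2, hcl3 q j h3 h4]
    refine ⟨w, (X p).toNat, (Y q).toNat, ?_, ?_, ?_, _, hit, ?_⟩
    · have := h.two_mul_le_left hX0 p; rw [pow_succ]; omega
    · have := h.two_mul_le_right hY0 q; rw [pow_succ]; omega
    · intro P Q hP hP' hQ hQ'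
      rw [Int.toNat_of_nonneg (hXn p)] at *
      rw [Int.toNat_of_nonneg (hYn q)] at *
      obtain ⟨i, j, a, b, ha, hb, rfl, rfl⟩ := h.exists_coord P Q
      have hXi := (h i j).1
      have hYj := (h i j).2.1
      have hi0 : 0 ≤ i := by
        by_contra hi
        have := h.strictMono_left.monotone (show i + 1 ≤ 0 by omega)
        omega
      have hj0 : 0 ≤ j := by
        by_contra hj
        have := h.strictMono_right.monotone (show j + 1 ≤ 0 by omega)
        omega
      have hip : i < p := h.strictMono_left.lt_iff_lt.1 (by omega)
      have hjq : j < q := h.strictMono_right.lt_iff_lt.1 (by omega)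
      refine ⟨fun hlt => h.right_eq_left ha hb fun e => ?_,
        fun hlt => h.top_eq_bottom ha hb fun e => ?_⟩
      · have hi1 : i + 1 < p := h.strictMono_left.lt_iff_lt.1 (by omega)
        rw [hzf i j hi0 hip hj0 hjq, hzf (i + 1) j (by omega) hi1 hj0 hjq]
        exact (hf i j hi0 hip hj0 hjq).1 hi1
      · have hj1 : j + 1 < q := h.strictMono_right.lt_iff_lt.1 (by omega)
        rw [hzf i j hi0 hip hj0 hjq, hzf i (j + 1) hi0 hip (by omega) hj1]
        exact (hf i j hi0 hip hj0 hjq).2 hj1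
    · refine ⟨fun n => (X n).toNat, fun n => (Y n).toNat, by simp [hX0], by simp [hY0], rfl, rfl, ?_⟩
      intro i j
      have hi : ((i : ℕ) : ℤ) < p := by exact_mod_cast i.2
      have hj : ((j : ℕ) : ℤ) < q := by exact_mod_cast j.2
      have hzz := hzf i j (by omega) hi (by omega) hj
      have hij := h i j
      rw [hzz] at hij
      refine ⟨?_, ?_, ?_⟩
      · have := hXn i; have := hij.1; simp only [subst]; push_cast; omega
      · have := hYn j; have := hij.2.1; simp only [subst]; push_cast; omega
      · intro a b P Q hP hQ
        have := hij.2.2 a b a.2 b.2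
        simp only [subst] at hP hQ ⊢
        rw [← this]
        have := hXn i; have := hYn j
        congr 2 <;> omega

theorem isExpansive_subst : IsExpansive subst := by
  intro a K
  obtain ⟨f, p, q, hp, hq, -, h⟩ := exists_isIteratedImage a (K + 1)
  have := Nat.lt_two_pow_self (n := K + 1)
  exact ⟨K + 1, _, h, by simp only; omega, by simp only; omega⟩

theorem isSelfSimilar_tilesU : IsSelfSimilar (wangShift tilesU) := by
  refine ⟨subst, isExpansive_subst, fun x hx => ?_, Set.ext fun z => ⟨fun hz => ?_, ?_⟩⟩
  · obtain ⟨w, X, Y, hX, hY, h⟩ := exists_isSubst_of_mem hx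
    exact ⟨w, isImageConfig_subst_iff.2 ⟨X, Y, hX, hY, h⟩⟩
  · obtain ⟨x, hx, X, Y, -, -, h⟩ := exists_desubstitution hz
    -- Shifting by `(X 0, Y 0)` moves the block of the letter at the origin to the origin, as
    -- `IsImageConfig` requires.
    refine ⟨x, hx, shift (X 0, Y 0) z, (-X 0, -Y 0), isImageConfig_subst_iff.2
      ⟨fun i => X i - X 0, fun j => Y j - Y 0, by simp, by simp, fun i j => ⟨?_, ?_, ?_⟩⟩, ?_⟩
    · simp only [(h i j).1]; ring
    · simp only [(h i j).2.1]; ring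
    · intro a b ha hb
      rw [← (h i j).2.2 a b ha hb]
      simp only [shift, Prod.mk_add_mk]
      congr 2 <;> ring
    · funext n
      have : n + (-X 0, -Y 0) + (X 0, Y 0) = n := by ext <;> simp
      simp only [shift, this]
  · rintro ⟨x, hx, y, k, hxy, rfl⟩
    obtain ⟨X, Y, -, -, h⟩ := isImageConfig_subst_iff.1 hxy
    exact shift_mem_wangShift (h.mem_wangShift hx) k

/-! ### The tilings by `𝒰` form a nonempty aperiodic minimal subshift -/

theorem isClosed_setOf_pair {A : Type} [TopologicalSpace A] [DiscreteTopology A] {ι : Type*}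
    (m n : ι) (P : A → A → Prop) : IsClosed {x : ι → A | P (x m) (x n)} := by
  have : Continuous fun x : ι → A => (x m, x n) := by fun_prop
  exact (isClosed_discrete {p : A × A | P p.1 p.2}).preimage this

theorem isClosed_wangShift {C ι : Type} [TopologicalSpace ι] [DiscreteTopology ι]
    (τ : ι → WangTile C) : IsClosed (wangShift τ) := by
  have : wangShift τ = ⋂ n : ℤ × ℤ,
      {x | (τ (x n)).right = (τ (x (n + (1, 0)))).left} ∩
        {x | (τ (x n)).top = (τ (x (n + (0, 1)))).bottom} := by
    ext x; simp [wangShift]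
  rw [this]
  exact isClosed_iInter fun n =>
    (isClosed_setOf_pair n (n + (1, 0)) fun a b => (τ a).right = (τ b).left).inter
      (isClosed_setOf_pair n (n + (0, 1)) fun a b => (τ a).top = (τ b).bottom)

theorem shift_shift {A : Type} (m n : ℤ × ℤ) (x : ℤ × ℤ → A) :
    shift m (shift n x) = shift (m + n) x := by
  funext k; simp [shift, add_assoc]

theorem shift_zero {A : Type} (x : ℤ × ℤ → A) : shift 0 x = x := by
  funext k; simp [shift]

theorem isShiftInvariant_of_forall_mem {A : Type} {X : Set (ℤ × ℤ → A)}
    (h : ∀ x ∈ X, ∀ n, shift n x ∈ X) : IsShiftInvariant X := fun n => by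
  ext x
  constructor
  · rintro ⟨y, hy, rfl⟩
    exact h y hy n
  · intro hx
    exact ⟨shift (-n) x, h x hx _, by rw [shift_shift, add_neg_cancel, shift_zero]⟩

theorem shift_mem_of_isShiftInvariant {A : Type} {X : Set (ℤ × ℤ → A)} (hX : IsShiftInvariant X)
    {x : ℤ × ℤ → A} (hx : x ∈ X) (n : ℤ × ℤ) : shift n x ∈ X := by
  rw [← hX n]; exact ⟨x, hx, rfl⟩

/-- Compactness: iterated images of a letter contain arbitrarily large valid squares. -/
theorem wangShift_tilesU_nonempty : (wangShift tilesU).Nonempty := by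
  set K : ℕ → Set (ℤ × ℤ → Fin 19) := fun m => ⋂ n : ℤ × ℤ, ⋂ _ : |n.1| < m ∧ |n.2| < m,
    {x | (tilesU (x n)).right = (tilesU (x (n + (1, 0)))).left} ∩
      {x | (tilesU (x n)).top = (tilesU (x (n + (0, 1)))).bottom} with hK
  have hcl : ∀ m, IsClosed (K m) := fun m => isClosed_iInter fun n => isClosed_iInter fun _ =>
    (isClosed_setOf_pair n (n + (1, 0)) fun a b => (tilesU a).right = (tilesU b).left).inter
      (isClosed_setOf_pair n (n + (0, 1)) fun a b => (tilesU a).top = (tilesU b).bottom)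
  have hne : (⋂ m, K m).Nonempty := by
    refine IsCompact.nonempty_iInter_of_sequence_nonempty_isCompact_isClosed K ?_ ?_
      (hcl 0).isCompact hcl
    · intro m
      refine Set.iInter_mono fun n => ?_
      refine Set.subset_iInter fun hn => Set.iInter_subset_of_subset ?_ le_rfl
      push_cast; omega
    · intro m
      -- A side above `2 * m + 1` leaves room, after centering, for all cells of the square and
      -- their right and upper neighbors.
      obtain ⟨f, p, q, hp, hq, hf, -⟩ := exists_isIteratedImage 0 (2 * m + 1)
      have hlt := Nat.lt_two_pow_self (n := 2 * m + 1)
      refine ⟨fun n => f (n + ((m : ℤ), (m : ℤ))), ?_⟩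
      simp only [hK, Set.mem_iInter]
      rintro ⟨i, j⟩ ⟨hi, hj⟩
      rw [abs_lt] at hi hj
      simp only at hi hj
      have := hf (i + m) (j + m) (by omega) (by omega) (by omega) (by omega)
      refine ⟨?_, ?_⟩
      · have := this.1 (by omega)
        simpa [add_right_comm] using this
      · have := this.2 (by omega)
        simpa [add_right_comm] using this
  obtain ⟨x, hx⟩ := hne
  refine ⟨x, fun n => ?_⟩
  have := Set.mem_iInter.1 hx (n.1.natAbs + n.2.natAbs + 1)
  simp only [hK, Set.mem_iInter] at this
  exact this n (by rw [Int.abs_eq_natAbs, Int.abs_eq_natAbs]; constructor <;> omega)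

namespace IsSubst

variable {z w : ℤ × ℤ → Fin 19} {X Y : ℤ → ℤ} (h : IsSubst z w X Y)

include h

theorem isNarrow_iff (p q : ℤ) : isNarrow (w (p, q)) ↔ ∃ i, p = X i + 1 := by
  obtain ⟨i, j, a, b, ha, hb, rfl, rfl⟩ := h.exists_coord p q
  rw [(h i j).2.2 a b ha hb, (substLetter_kinds ha hb).1]
  constructor
  · rintro rfl; exact ⟨i, by simp⟩
  · rintro ⟨i', hi'⟩
    have hX := (h i j).1
    have hX' := (h i' j).1
    have := two_le_substWidth (z (i', j))
    have : i' = i := h.strictMono_left.int_index_unique (m := X i + a)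
      (by omega) (by omega) (by omega) (by omega)
    subst this; omega

theorem isShort_iff (p q : ℤ) : isShort (w (p, q)) ↔ ∃ j, q = Y j := by
  obtain ⟨i, j, a, b, ha, hb, rfl, rfl⟩ := h.exists_coord p q
  rw [(h i j).2.2 a b ha hb, (substLetter_kinds ha hb).2]
  constructor
  · rintro rfl; exact ⟨j, by simp⟩
  · rintro ⟨j', hj'⟩
    have hY := (h i j).2.1
    have hY' := (h i j').2.1
    have := two_le_substHeight (z (i, j'))
    have : j' = j := h.strictMono_right.int_index_unique (m := Y j + b)
      (by omega) (by omega) (by omega) (by omega)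
    subst this; omega

theorem isNarrow_preimage (i j : ℤ) : isNarrow (z (i, j)) = isNarrow (w (X i + 3, Y j)) := by
  rw [Bool.eq_iff_iff, h.isNarrow_iff]
  have hX := (h i j).1
  constructor
  · intro hn
    rw [substWidth, if_pos hn] at hX
    exact ⟨i + 1, by push_cast at hX; omega⟩
  · rintro ⟨i', hi'⟩
    by_contra hn
    rw [substWidth, if_neg hn] at hX
    have h1 : i < i' := h.strictMono_left.lt_iff_lt.1 (by omega)
    have h2 : i' < i + 1 := h.strictMono_left.lt_iff_lt.1 (by push_cast at hX; omega)
    omega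

theorem isShort_preimage (i j : ℤ) : isShort (z (i, j)) = isShort (w (X i, Y j + 2)) := by
  rw [Bool.eq_iff_iff, h.isShort_iff]
  have hY := (h i j).2.1
  constructor
  · intro hn
    rw [substHeight, if_pos hn] at hY
    exact ⟨j + 1, by push_cast at hY; omega⟩
  · rintro ⟨j', hj'⟩
    by_contra hn
    rw [substHeight, if_neg hn] at hY
    have h1 : j < j' := h.strictMono_right.lt_iff_lt.1 (by omega)
    have h2 : j' < j + 1 := h.strictMono_right.lt_iff_lt.1 (by push_cast at hY; omega)
    omega

/-- Recognizability: the cells at offsets 3 and 2 give the size of the block, and among letters with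
blocks of one size the morphism is injective. -/
theorem preimage_eq {i j i' j' : ℤ}
    (he : ∀ a b : ℤ, w (X i + a, Y j + b) = w (X i' + a, Y j' + b)) :
    z (i, j) = z (i', j') := by
  have hn : isNarrow (z (i, j)) = isNarrow (z (i', j')) := by
    rw [h.isNarrow_preimage, h.isNarrow_preimage]
    simpa using congrArg isNarrow (he 3 0)
  have hs : isShort (z (i, j)) = isShort (z (i', j')) := by
    rw [h.isShort_preimage, h.isShort_preimage]
    simpa using congrArg isShort (he 0 2)
  have hW : substWidth (z (i, j)) = substWidth (z (i', j')) := by rw [substWidth, hn, substWidth]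
  have hH : substHeight (z (i, j)) = substHeight (z (i', j')) := by
    rw [substHeight, hs, substHeight]
  refine substLetter_injective _ _ hW hH fun a ha b hb => ?_
  rw [← (h i j).2.2 a b ha hb, ← (h i' j').2.2 a b (hW ▸ ha) (hH ▸ hb), he]

theorem add_two_mul_le_left (i : ℤ) (n : ℕ) : X i + 2 * n ≤ X (i + n) := by
  induction n with
  | zero => simp
  | succ n ih =>
    have := (h (i + n) 0).1; have := two_le_substWidth (z (i + n, 0))
    push_cast; rw [← add_assoc]; omega

theorem add_two_mul_le_right (j : ℤ) (n : ℕ) : Y j + 2 * n ≤ Y (j + n) := by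
  induction n with
  | zero => simp
  | succ n ih =>
    have := (h 0 (j + n)).2.1; have := two_le_substHeight (z (0, j + n))
    push_cast; rw [← add_assoc]; omega

/-- A period of a tiling induces a shorter period of its preimage. -/
theorem exists_period {a b : ℤ} (hp : shift (a, b) w = w) :
    ∃ k l : ℤ, shift (k, l) z = z ∧ 2 * k.natAbs ≤ a.natAbs ∧ 2 * l.natAbs ≤ b.natAbs ∧
      (k = 0 → a = 0) ∧ (l = 0 → b = 0) := by
  have hper : ∀ p q, w (p + a, q + b) = w (p, q) := fun p q => congrFun hp (p, q)
  -- A period preserves narrow columns and short rows, hence permutes the cuts.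
  have hφ : ∀ i, ∃ i', X i' = X i + a := fun i => by
    have : isNarrow (w (X i + 1 + a, 0 + b)) := by rw [hper, h.isNarrow_iff]; exact ⟨i, rfl⟩
    rw [h.isNarrow_iff] at this
    obtain ⟨i', hi'⟩ := this
    exact ⟨i', by omega⟩
  have hψ : ∀ j, ∃ j', Y j' = Y j + b := fun j => by
    have : isShort (w (0 + a, Y j + b)) := by rw [hper, h.isShort_iff]; exact ⟨j, rfl⟩
    rw [h.isShort_iff] at this
    obtain ⟨j', hj'⟩ := this
    exact ⟨j', by omega⟩
  choose φ hφ using hφ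
  choose ψ hψ using hψ
  have hz : ∀ i j, z (φ i, ψ j) = z (i, j) := fun i j => by
    refine h.preimage_eq fun c d => ?_
    rw [hφ, hψ, add_right_comm, add_right_comm (Y j), hper]
  -- Corresponding blocks come from equal letters and have equal widths, so successive cuts go to
  -- successive cuts and `φ` is a translation.
  have hφ1 : ∀ i, φ (i + 1) = φ i + 1 := fun i => by
    apply h.strictMono_left.injective
    rw [hφ, (h (φ i) (ψ 0)).1, hφ, hz, (h i 0).1]
    ring
  have hψ1 : ∀ j, ψ (j + 1) = ψ j + 1 := fun j => by
    apply h.strictMono_right.injective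
    rw [hψ, (h (φ 0) (ψ j)).2.1, hψ, hz, (h 0 j).2.1]
    ring
  have hφ0 : ∀ i, φ i = i + φ 0 := fun i => by
    have : φ i - i = φ 0 - 0 :=
      int_const_of_succ (f := fun i => φ i - i) (fun i => by simp only [hφ1]; ring) i
    omega
  have hψ0 : ∀ j, ψ j = j + ψ 0 := fun j => by
    have : ψ j - j = ψ 0 - 0 :=
      int_const_of_succ (f := fun j => ψ j - j) (fun j => by simp only [hψ1]; ring) j
    omega
  refine ⟨φ 0, ψ 0, ?_, ?_, ?_, ?_, ?_⟩
  · funext ⟨i, j⟩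
    rw [← hz i j, hφ0 i, hψ0 j]; rfl
  -- Between the cuts `X 0` and `X (φ 0)`, at distance `|a|`, lie `|φ 0|` blocks of width at least
  -- 2.
  · have h0 := hφ 0
    obtain hk | hk := le_total 0 (φ 0)
    · have := h.add_two_mul_le_left 0 (φ 0).natAbs
      rw [show (0 : ℤ) + (φ 0).natAbs = φ 0 by omega] at this
      omega
    · have := h.add_two_mul_le_left (φ 0) (φ 0).natAbs
      rw [show φ 0 + (φ 0).natAbs = 0 by omega] at this
      omega
  · have h0 := hψ 0
    obtain hk | hk := le_total 0 (ψ 0)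
    · have := h.add_two_mul_le_right 0 (ψ 0).natAbs
      rw [show (0 : ℤ) + (ψ 0).natAbs = ψ 0 by omega] at this
      omega
    · have := h.add_two_mul_le_right (ψ 0) (ψ 0).natAbs
      rw [show ψ 0 + (ψ 0).natAbs = 0 by omega] at this
      omega
  · intro h0; have := hφ 0; rw [h0] at this; omega
  · intro h0; have := hψ 0; rw [h0] at this; omega

end IsSubst

/-- Infinite descent on the size of the period: it is at least halved in the preimage, and can
vanish there only if it was zero. -/
theorem eq_zero_of_period {w : ℤ × ℤ → Fin 19} (hw : w ∈ wangShift tilesU) {n : ℤ × ℤ}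
    (hn : shift n w = w) : n = 0 := by
  obtain ⟨a, b⟩ := n
  induction hN : a.natAbs + b.natAbs using Nat.strong_induction_on generalizing a b w with
  | _ N ih =>
    obtain ⟨z, hz, X, Y, -, -, h⟩ := exists_desubstitution hw
    obtain ⟨k, l, hp, hk, hl, hk0, hl0⟩ := h.exists_period hn
    by_cases h0 : a.natAbs + b.natAbs = 0
    · ext <;> simp <;> omega
    · have := ih (k.natAbs + l.natAbs) (by omega) hz k l hp rfl
      simp only [Prod.mk_eq_zero] at this
      rw [hk0 this.1, hl0 this.2]; rfl

/-! ### Every pattern of a tiling by `𝒰` appears in every tiling by `𝒰` -/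

/-- The letter in column `p` and row `r` of the image of `q`. -/
def Quad.imageLetter (q : Quad) (p r : ℕ) : Fin 19 :=
  if p < substWidth q.1 then
    if r < substHeight q.1 then substLetter q.1 p r
    else substLetter q.2.2.1 p (r - substHeight q.1)
  else if r < substHeight q.1 then substLetter q.2.1 (p - substWidth q.1) r
    else substLetter q.2.2.2 (p - substWidth q.1) (r - substHeight q.1)

/-- The patterns of shape `(2, 2)` in the image of `q`. -/
def Quad.subquads (q : Quad) : List Quad :=
  (List.range (substWidth q.1 + substWidth q.2.1 - 1)).flatMap fun p =>
    (List.range (substHeight q.1 + substHeight q.2.2.1 - 1)).map fun r =>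
      (q.imageLetter p r, q.imageLetter (p + 1) r, q.imageLetter p (r + 1),
        q.imageLetter (p + 1) (r + 1))

namespace IsSubst

variable {z w : ℤ × ℤ → Fin 19} {X Y : ℤ → ℤ} (h : IsSubst z w X Y)

include h

theorem imageLetter_quadAt (i j : ℤ) {p r : ℕ}
    (hp : p < substWidth (z (i, j)) + substWidth (z (i + 1, j)))
    (hr : r < substHeight (z (i, j)) + substHeight (z (i, j + 1))) :
    w (X i + p, Y j + r) = (quadAt z (i, j)).imageLetter p r := by
  have h00 := h i j
  have h10 := h (i + 1) j
  have h01 := h i (j + 1)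
  have h11 := h (i + 1) (j + 1)
  simp only [Quad.imageLetter, quadAt, Prod.mk_add_mk, add_zero]
  split_ifs with h1 h2 h2
  · exact h00.2.2 _ _ h1 h2
  · have := h01.2.2 p (r - substHeight (z (i, j)))
    rw [← this (by have := h00.1; have := h01.1; omega) (by omega), h00.2.1]
    congr 2; omega
  · have := h10.2.2 (p - substWidth (z (i, j))) r
    rw [← this (by omega) (by have := h00.2.1; have := h10.2.1; omega), h00.1]
    congr 2; omega
  · have := h11.2.2 (p - substWidth (z (i, j))) (r - substHeight (z (i, j)))
    rw [← this (by have := h10.1; have := h11.1; omega) (by have := h01.2.1; have := h11.2.1; omega),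
      h00.1, h00.2.1]
    congr 2 <;> omega

theorem exists_quadAt_eq {n : ℤ × ℤ} {s : Quad} (hs : s ∈ (quadAt z n).subquads) :
    ∃ m, quadAt w m = s := by
  obtain ⟨i, j⟩ := n
  simp only [Quad.subquads, List.mem_flatMap, List.mem_range, List.mem_map] at hs
  obtain ⟨p, hp, r, hr, rfl⟩ := hs
  simp only [quadAt, Prod.mk_add_mk, add_zero] at hp hr
  refine ⟨(X i + p, Y j + r), ?_⟩
  rw [← h.imageLetter_quadAt i j (by omega) (by omega),
    ← h.imageLetter_quadAt i j (by omega) (by omega),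
    ← h.imageLetter_quadAt i j (by omega) (by omega),
    ← h.imageLetter_quadAt i j (by omega) (by omega)]
  simp [quadAt, add_assoc]

end IsSubst

/-- The pattern `q` appears in every tiling by `𝒰`. -/
def Quad.IsRecurrent (q : Quad) : Prop :=
  ∀ w ∈ wangShift tilesU, ∃ n, quadAt w n = q

/-- Every tiling is the image of a tiling, in which `q` appears. -/
theorem Quad.IsRecurrent.of_mem_subquads {q s : Quad} (hq : q.IsRecurrent)
    (hs : s ∈ q.subquads) : s.IsRecurrent := fun w hw => by
  obtain ⟨z, hz, X, Y, -, -, h⟩ := exists_desubstitution hw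
  obtain ⟨n, rfl⟩ := hq z hz
  exact h.exists_quadAt_eq hs

/-- The patterns that appear in the image of a pattern of `S`. -/
def quadsOfImages (S : List Quad) : List Quad :=
  quads.filter fun s => S.any fun q => q.subquads.contains s

theorem isRecurrent_quadsOfImages {S : List Quad} (hS : ∀ q ∈ S, q.IsRecurrent) :
    ∀ q ∈ quadsOfImages S, q.IsRecurrent := fun s hs => by
  simp only [quadsOfImages, List.mem_filter, List.any_eq_true, List.contains_iff_mem] at hs
  obtain ⟨-, q, hq, hsq⟩ := hs
  exact (hS q hq).of_mem_subquads hsq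

/-- Together with `quads_subset_third_image` this is primitivity: one pattern lies in the second
image of every pattern, and its third image yields all of them. -/
theorem mem_second_image : quads.all (fun q => q.subquads.any fun r =>
    r.subquads.contains (6, 5, 17, 13)) = true := by
  decide +kernel

theorem quads_subset_third_image : quads.all (fun q =>
    (quadsOfImages (quadsOfImages (quadsOfImages [(6, 5, 17, 13)]))).contains q) = true := by
  decide +kernel

theorem isRecurrent_of_mem_quads {q : Quad} (hq : q ∈ quads) : q.IsRecurrent := by
  have h0 : ∀ q : Quad, q ∈ [((6, 5, 17, 13) : Quad)] → q.IsRecurrent := by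
    intro q hq w hw
    rw [List.mem_singleton.1 hq]
    obtain ⟨z, hz, X, Y, -, -, h⟩ := exists_desubstitution hw
    obtain ⟨z', hz', X', Y', -, -, h'⟩ := exists_desubstitution hz
    have := List.all_eq_true.1 mem_second_image _ (quadAt_mem_quads hz' 0)
    simp only [List.any_eq_true, List.contains_iff_mem] at this
    obtain ⟨r, hr, hr'⟩ := this
    obtain ⟨n, rfl⟩ := h'.exists_quadAt_eq hr
    exact h.exists_quadAt_eq hr'
  have := List.all_eq_true.1 quads_subset_third_image q hq
  exact isRecurrent_quadsOfImages (isRecurrent_quadsOfImages (isRecurrent_quadsOfImages h0)) q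
    (List.contains_iff_mem.1 this)

/-- Every square pattern of a tiling by `𝒰` appears in every tiling by `𝒰`. -/
theorem exists_occurrence (N : ℕ) {w w' : ℤ × ℤ → Fin 19} (hw : w ∈ wangShift tilesU)
    (hw' : w' ∈ wangShift tilesU) (p : ℤ × ℤ) : ∃ q : ℤ × ℤ, ∀ a b : ℕ, a < N → b < N →
      w' (p + ((a : ℤ), (b : ℤ))) = w (q + ((a : ℤ), (b : ℤ))) := by
  induction N using Nat.strong_induction_on generalizing w w' p with
  | _ N ih =>
  -- Desubstitution cannot shrink a 2 × 2 window that meets four blocks, so this size is the base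
  -- case.
  by_cases hN : N ≤ 2
  · obtain ⟨q, hq⟩ := isRecurrent_of_mem_quads (quadAt_mem_quads hw' p) w hw
    simp only [quadAt, Prod.mk.injEq] at hq
    refine ⟨q, fun a b ha hb => ?_⟩
    have ha' : a < 2 := by omega
    have hb' : b < 2 := by omega
    clear ha hb
    have e : ∀ n : ℤ × ℤ, n + (0, 0) = n := fun n => add_zero n
    interval_cases a <;> interval_cases b <;> simp [hq, e]
  · obtain ⟨z, hz, X, Y, -, -, h⟩ := exists_desubstitution hw
    obtain ⟨z', hz', X', Y', -, -, h'⟩ := exists_desubstitution hw'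
    obtain ⟨p1, p2⟩ := p
    obtain ⟨i, j, a0, b0, ha0, hb0, rfl, rfl⟩ := h'.exists_coord p1 p2
    obtain ⟨⟨k, l⟩, hkl⟩ := ih (N - 1) (by omega) hz hz' (i, j)
    simp only [Prod.mk_add_mk] at hkl
    -- Equal letters have blocks of equal size, so the cuts of both tilings agree relative to the
    -- first block.
    have hX : ∀ c : ℕ, c ≤ N - 1 → X' (i + c) - X' i = X (k + c) - X k := by
      intro c hc
      induction c with
      | zero => simp
      | succ c ihc =>
        have h1 := (h' (i + c) j).1
        have h2 := (h (k + c) l).1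
        have h3 := hkl c 0 (by omega) (by omega)
        simp only [Nat.cast_zero, add_zero] at h3
        have := ihc (by omega)
        rw [h3] at h1
        push_cast; rw [← add_assoc, ← add_assoc, h1, h2]; omega
    have hY : ∀ c : ℕ, c ≤ N - 1 → Y' (j + c) - Y' j = Y (l + c) - Y l := by
      intro c hc
      induction c with
      | zero => simp
      | succ c ihc =>
        have h1 := (h' i (j + c)).2.1
        have h2 := (h k (l + c)).2.1
        have h3 := hkl 0 c (by omega) (by omega)
        simp only [Nat.cast_zero, add_zero] at h3
        have := ihc (by omega)
        rw [h3] at h1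
        push_cast; rw [← add_assoc, ← add_assoc, h1, h2]; omega
    refine ⟨(X k + a0, Y l + b0), fun a b ha hb => ?_⟩
    simp only [Prod.mk_add_mk]
    obtain ⟨i', j', a', b', ha', hb', hia, hjb⟩ :=
      h'.exists_coord (X' i + a0 + a) (Y' j + b0 + b)
    have hi : i ≤ i' := by
      by_contra hlt
      have := h'.strictMono_left.monotone (show i' + 1 ≤ i by omega)
      have := (h' i' j').1
      omega
    have hj : j ≤ j' := by
      by_contra hlt
      have := h'.strictMono_right.monotone (show j' + 1 ≤ j by omega)
      have := (h' i' j').2.1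
      omega
    obtain ⟨c, rfl⟩ := Int.le.dest hi
    obtain ⟨d, rfl⟩ := Int.le.dest hj
    -- As blocks are at least 2 wide, `N` columns reach at most `N / 2` blocks past the first one,
    -- and `N / 2 < N - 1` for `N ≥ 3`.
    have hc : c < N - 1 := by
      obtain _ | c := c
      · omega
      · have h1 := h'.add_two_mul_le_left (i + 1) c
        have h2 := (h' i j).1
        rw [show i + 1 + (c : ℤ) = i + ((c + 1 : ℕ) : ℤ) by push_cast; ring] at h1
        omega
    have hd : d < N - 1 := by
      obtain _ | d := d
      · omega
      · have h1 := h'.add_two_mul_le_right (j + 1) d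
        have h2 := (h' i j).2.1
        rw [show j + 1 + (d : ℤ) = j + ((d + 1 : ℕ) : ℤ) by push_cast; ring] at h1
        omega
    have e := hkl c d hc hd
    have e1 := hX c (by omega)
    have e2 := hY d (by omega)
    have hw1 := (h' (i + c) (j + d)).2.2 a' b' ha' hb'
    rw [e] at ha' hb'
    have hw2 := (h (k + c) (l + d)).2.2 a' b' ha' hb'
    rw [hia, hjb, hw1, e, ← hw2]
    congr 2 <;> omega

theorem isSubshift_tilesU : IsSubshift (wangShift tilesU) :=
  ⟨isClosed_wangShift _, isShiftInvariant_of_forall_mem fun _ hx n => shift_mem_wangShift hx n⟩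

/-- A basic neighborhood of `x` constrains finitely many cells; a centered square containing them
reappears in `y`, hence at the origin of a shift of `y`. -/
theorem isMinimalSubshift_tilesU : IsMinimalSubshift (wangShift tilesU) := by
  refine ⟨isSubshift_tilesU, fun Z hZ ⟨y, hy⟩ hZs => hZ.antisymm fun x hx => ?_⟩
  rw [← hZs.1.closure_eq, mem_closure_iff_nhds]
  intro U hU
  rw [nhds_pi, Filter.mem_pi] at hU
  obtain ⟨I, hI, t, ht, hU⟩ := hU
  obtain ⟨M, hM⟩ : ∃ M : ℕ, ∀ n ∈ I, n.1.natAbs ≤ M ∧ n.2.natAbs ≤ M := by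
    obtain ⟨M, hM⟩ := (hI.image fun n => n.1.natAbs + n.2.natAbs).bddAbove
    exact ⟨M, fun n hn => by
      have : n.1.natAbs + n.2.natAbs ≤ M := hM ⟨n, hn, rfl⟩
      omega⟩
  obtain ⟨q, hq⟩ := exists_occurrence (2 * M + 1) (hZ hy) hx (-(M : ℤ), -(M : ℤ))
  refine ⟨shift (q + ((M : ℤ), (M : ℤ))) y, hU fun n hn => ?_,
    shift_mem_of_isShiftInvariant hZs.2 hy _⟩
  have hb := hM n hn
  have := hq (n.1 + M).toNat (n.2 + M).toNat (by omega) (by omega)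
  rw [Int.toNat_of_nonneg (by omega), Int.toNat_of_nonneg (by omega)] at this
  have e : shift (q + ((M : ℤ), (M : ℤ))) y n = x n := by
    rw [show n = (-(M : ℤ), -(M : ℤ)) + (n.1 + M, n.2 + M) by ext <;> simp, this]
    simp only [shift]
    congr 1
    ext <;> simp <;> ring
  rw [e]
  exact mem_of_mem_nhds (ht n)

/-! ### The patches -/

/-- The tiles of the patches, as hexadecimal digits: eight digits for each row, the top row first
(a row of a narrow patch ends with three digits `0` that are not used). -/
def patchData : List ℕ :=
  [0x57566000287570007387300011111000666660005745700073a280009987300000111000,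
    0x57566000287570007387300011111000666660005745700043a28000a387300011111000,
    0x6745757443a2873aa387399811111001666666755745728773a287389987399900111000,
    0x6745757443a2873aa387399911111000666666745745743a73a43a38999a399900011000,
    0x575666742875743a73873a3811111111666666665745757473a2873a9987399900111000,
    0x575666742875743a73873a3811111111666666665745757443a2873aa387399911111000,
    0x6745667443a5743aa3873a3811111111666666665745757473a2873a9987399900111000,
    0x5745667443a5743aa3873a3811111111566666665745757473a2873a9987399900111000,
    0x57566000287570007387300099999000000000005745700043a28000a387300011111000566660005745700073a280009987300000111000,
    0x566660005745700073a28000998730000011100057566000287570007387300011111000666660005745700073a280009987300000111000,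
    0x566660005745700073a28000998730000011100057566000287570007387300011111000666660005745700043a28000a387300011111000,
    0x566660005745700073a43000999a3000000110005745600043a57000a387300011111000566660005745700073a280009987300000111000,
    0x675666742875743a73873a3899999999000000006745757443a2873aa387399811111001666666755745728773a287389987399900111000,
    0x575666742875743a73873a3899999999000000005745757443a2873aa387399811111001566666755745728773a287389987399900111000,
    0x675666742875743a73873a3899999999000000006745757443a2873aa387399911111000666666745745743a73a43a38999a399900011000,
    0x575666742875743a73873a3899999999000000005745757443a2873aa387399911111000566666745745743a73a43a38999a399900011000,
    0x6745667443a5743aa3873a3899999999000000005745757473a2873a9987399900111000675666742875743a73873a389999999900000000,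
    0x6745667443a5743aa3873a3899999999000000006745757443a2873aa387399911111000666666745745743a73a43a38999a399900011000,
    0x566666745745743a73a43a38999a3999000110005745667443a5743aa3873a3811111111566666665745757473a2873a9987399900111000]

/-- The rows of a patch are divided into horizontal strips; the displacement of row `b` to the right
is the index of its strip. -/
def patchShear (b : ℕ) : ℕ :=
  if Nat.blt b 5 then 0 else if Nat.blt b 9 then 1 else if Nat.blt b 14 then 2 else 3

def patchWidth (t : Fin 19) : ℕ := if isNarrow t then 5 else 8

def patchHeight (t : Fin 19) : ℕ := if isShort t then 9 else 14

/-- The Jeandel-Rao tile number `a` in row `b` of the patch with index `t`. -/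
def patchTile (t : Fin 19) (a b : ℕ) : Fin 11 :=
  Fin.ofNat 11 (patchData.getD t 0 / 16 ^ (8 * b + (7 - a)) % 16)

/-- In a row of patches, the tile in row `b` that is `a - 8` columns to the right of the start of
the row in the patch `c`, the neighbors of which are `l` and `r`. -/
def rowTile (l c r : Fin 19) (a b : ℕ) : Option (Fin 11) :=
  -- The bounds 3 = 8 - 5 and 13 = 8 + 5 restrict the lookup to five columns of each neighbor, the
  -- least width of a patch.
  if a < 8 then if 3 ≤ a then some (patchTile l (a + patchWidth l - 8) b) else none
  else if a - 8 < patchWidth c then some (patchTile c (a - 8) b)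
  else if a < patchWidth c + 13 then some (patchTile r (a - 8 - patchWidth c) b) else none

/-- The tile at displacement `(dx - 8, dy)` from the tile `(a, b)` of the patch of index
`r.1 = l.2.1`; the patterns `l` and `r` give the patches around it. -/
def relativeTile (l r : Quad) (a b dx dy : ℕ) : Option (Fin 11) :=
  if b + dy < patchHeight r.1 then
    rowTile l.1 r.1 r.2.1 (patchShear b + a + dx - patchShear (b + dy)) (b + dy)
  -- 9 is the least height of a patch, so the row exists in the upper patches.
  else if b + dy - patchHeight r.1 < 9 then
    rowTile l.2.2.1 r.2.2.1 r.2.2.2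
      (patchShear b + a + dx - patchShear (patchHeight r.1) -
        patchShear (b + dy - patchHeight r.1)) (b + dy - patchHeight r.1)
  else none

/-- All tiles of the patch of index `t` satisfy `f`. -/
def forallTiles (t : Fin 19) (f : ℕ → ℕ → Bool) : Bool :=
  (List.range (patchWidth t)).all fun a => (List.range (patchHeight t)).all fun b => f a b

/-- The arguments `9 0` encode the displacement (1, 0), the horizontal one being stored with 8
added. An undetermined tile counts as failure, so the table always answers. -/
theorem patches_match_right : quads.all (fun l => quads.all fun r => !l.adjRight r ||
    forallTiles r.1 fun a b => match relativeTile l r a b 9 0 with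
      | some s => decide ((jeandelRao (patchTile r.1 a b)).right = (jeandelRao s).left)
      | none => false) = true := by
  decide +kernel

theorem patches_match_top : quads.all (fun l => quads.all fun r => !l.adjRight r ||
    forallTiles r.1 fun a b => match relativeTile l r a b 8 1 with
      | some s => decide ((jeandelRao (patchTile r.1 a b)).top = (jeandelRao s).bottom)
      | none => false) = true := by
  decide +kernel

/-- Quadruples `((a, b), (a', b'))` of coordinates in a patch, with tiles `s`, `s'`, listed as
`(a, b, s, a', b', s')`. -/
def signatures : List (ℕ × ℕ × Fin 11 × ℕ × ℕ × Fin 11) :=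
  [(0, 5, 1, 3, 7, 5), (3, 7, 2, 5, 9, 0), (5, 5, 0, 0, 8, 6), (2, 1, 8, 3, 9, 0)]

/-- The patch of index `t` has the two tiles of a signature. -/
def hasSignature (t : Fin 19) : ℕ × ℕ × Fin 11 × ℕ × ℕ × Fin 11 → Bool
  | (a, b, s, a', b', s') => Nat.blt a (patchWidth t) && Nat.blt b (patchHeight t) &&
      Nat.blt a' (patchWidth t) && Nat.blt b' (patchHeight t) &&
      patchTile t a b == s && patchTile t a' b' == s'

theorem exists_hasSignature : (List.finRange 19).all (fun t => signatures.any (hasSignature t)) =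
    true := by
  decide +kernel

/-- The tiles of a signature are found at its displacement only if the first one has the
coordinates given by the signature. -/
theorem signatures_rigid : signatures.all (fun σ => match σ with
    | (a, b, s, a', b', s') => quads.all fun l => quads.all fun r => !l.adjRight r ||
        forallTiles r.1 fun p q => !(patchTile r.1 p q == s) || (p == a && q == b) ||
          match relativeTile l r p q (a' + patchShear b' + 8 - (a + patchShear b)) (b' - b) with
          | some v => !(v == s')
          | none => false) = true := by
  decide +kernel

theorem patchTile_injective : (List.finRange 19).all (fun t => (List.finRange 19).all fun u =>
    t == u || !(isNarrow t == isNarrow u) || !(isShort t == isShort u) ||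
      !forallTiles t fun a b => patchTile t a b == patchTile u a b) = true := by
  decide +kernel

theorem exists_quad_fst : (List.finRange 19).all (fun t => quads.any fun q => q.1 == t) = true := by
  decide +kernel

/-! ### Configurations composed of patches -/

/-- The displacement of the tile `(a, b)` of a patch from the lower left tile. -/
def patchOffset (a b : ℕ) : ℤ × ℤ := ((patchShear b : ℤ) + a, (b : ℤ))

/-- The places of the patches: the patch of index `(i, j)` starts at `(X i + S j, Y j)`. -/
structure Layout where
  X : ℤ → ℤ
  S : ℤ → ℤ
  Y : ℤ → ℤ

def Layout.pos (L : Layout) (n : ℤ × ℤ) : ℤ × ℤ := (L.X n.1 + L.S n.2, L.Y n.2)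

/-- `x` is composed of the patches of indices `w n`, placed as described by `L`. -/
def IsPatchwork (x : ℤ × ℤ → Fin 11) (w : ℤ × ℤ → Fin 19) (L : Layout) : Prop :=
  ∀ i j : ℤ,
    L.X (i + 1) = L.X i + patchWidth (w (i, j)) ∧
    L.S (j + 1) = L.S j + patchShear (patchHeight (w (i, j))) ∧
    L.Y (j + 1) = L.Y j + patchHeight (w (i, j)) ∧
    ∀ a b, a < patchWidth (w (i, j)) → b < patchHeight (w (i, j)) →
      x (L.pos (i, j) + patchOffset a b) = patchTile (w (i, j)) a b

theorem patchWidth_bounds (t : Fin 19) : 5 ≤ patchWidth t ∧ patchWidth t ≤ 8 := by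
  unfold patchWidth; split <;> simp

theorem patchHeight_bounds (t : Fin 19) : 9 ≤ patchHeight t ∧ patchHeight t ≤ 14 := by
  unfold patchHeight; split <;> simp

theorem forallTiles_iff {t : Fin 19} {f : ℕ → ℕ → Bool} : forallTiles t f = true ↔
    ∀ a b, a < patchWidth t → b < patchHeight t → f a b = true := by
  simp only [forallTiles, List.all_eq_true, List.mem_range]
  exact ⟨fun h a b ha hb => h a ha b hb, fun h a ha b hb => h a b ha hb⟩

theorem patchOffset_injective {a b a' b' : ℕ} (h : patchOffset a b = patchOffset a' b') :
    a = a' ∧ b = b' := by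
  simp only [patchOffset, Prod.mk.injEq, Nat.cast_inj] at h
  obtain ⟨h1, rfl⟩ := h
  exact ⟨by omega, rfl⟩

namespace IsPatchwork

variable {x : ℤ × ℤ → Fin 11} {w : ℤ × ℤ → Fin 19} {L : Layout} (h : IsPatchwork x w L)

include h

theorem X_strictMono : StrictMono L.X :=
  strictMono_int_of_lt_succ fun i => by
    have := (h i 0).1; have := patchWidth_bounds (w (i, 0)); omega

theorem Y_strictMono : StrictMono L.Y :=
  strictMono_int_of_lt_succ fun j => by
    have := (h 0 j).2.2.1; have := patchHeight_bounds (w (0, j)); omega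

theorem tile_eq (n : ℤ × ℤ) {a b : ℕ} (ha : a < patchWidth (w n)) (hb : b < patchHeight (w n)) :
    x (L.pos n + patchOffset a b) = patchTile (w n) a b :=
  (h n.1 n.2).2.2.2 a b ha hb

theorem pos_right (n : ℤ × ℤ) : L.pos (n + (1, 0)) = L.pos n + ((patchWidth (w n) : ℤ), 0) := by
  have := (h n.1 n.2).1
  ext <;> simp [Layout.pos, this]; ring

theorem pos_up (n : ℤ × ℤ) : L.pos (n + (0, 1)) =
    L.pos n + ((patchShear (patchHeight (w n)) : ℤ), (patchHeight (w n) : ℤ)) := by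
  have h1 := (h n.1 n.2).2.1
  have h2 := (h n.1 n.2).2.2.1
  ext <;> simp [Layout.pos, h1, h2]; ring

theorem pos_injective : Function.Injective L.pos := by
  rintro ⟨i, j⟩ ⟨i', j'⟩ hn
  simp only [Layout.pos, Prod.mk.injEq] at hn
  obtain rfl := h.Y_strictMono.injective hn.2
  obtain rfl := h.X_strictMono.injective (add_right_cancel hn.1)
  rfl

theorem patchHeight_eq (i i' j : ℤ) : patchHeight (w (i, j)) = patchHeight (w (i', j)) := by
  have h1 := (h i j).2.2.1
  have h2 := (h i' j).2.2.1
  omega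

theorem exists_coord (m : ℤ × ℤ) : ∃ n : ℤ × ℤ, ∃ a b : ℕ, a < patchWidth (w n) ∧
    b < patchHeight (w n) ∧ m = L.pos n + patchOffset a b := by
  obtain ⟨j, hj, hj'⟩ := h.Y_strictMono.exists_int_index m.2
  obtain ⟨b, hb⟩ := Int.eq_ofNat_of_zero_le (sub_nonneg.2 hj)
  -- The shear depends on the row within the patch, so the column is located after the row.
  obtain ⟨i, hi, hi'⟩ := h.X_strictMono.exists_int_index (m.1 - L.S j - patchShear b)
  obtain ⟨a, ha⟩ := Int.eq_ofNat_of_zero_le (sub_nonneg.2 hi)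
  have h1 := (h i j).1
  have h2 := (h i j).2.2.1
  refine ⟨(i, j), a, b, by omega, by omega, ?_⟩
  ext <;> simp [Layout.pos, patchOffset] <;> omega

theorem coord_unique {n n' : ℤ × ℤ} {a b a' b' : ℕ} (ha : a < patchWidth (w n))
    (hb : b < patchHeight (w n)) (ha' : a' < patchWidth (w n')) (hb' : b' < patchHeight (w n'))
    (he : L.pos n + patchOffset a b = L.pos n' + patchOffset a' b') : n = n' ∧ a = a' ∧ b = b' := by
  obtain ⟨i, j⟩ := n
  obtain ⟨i', j'⟩ := n'
  have h1 := (h i j).1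
  have h2 := (h i j).2.2.1
  have h1' := (h i' j').1
  have h2' := (h i' j').2.2.1
  simp only [Layout.pos, patchOffset, Prod.mk_add_mk, Prod.mk.injEq] at he
  obtain rfl := h.Y_strictMono.int_index_unique (m := L.Y j + b) (k := j) (l := j')
    (by omega) (by omega) (by omega) (by omega)
  obtain rfl : b = b' := by omega
  obtain rfl := h.X_strictMono.int_index_unique (m := L.X i + a) (k := i) (l := i')
    (by omega) (by omega) (by omega) (by omega)
  exact ⟨rfl, by omega, rfl⟩

theorem rowTile_spec {i j : ℤ} {a b : ℕ} {v : Fin 11} (hb : b < patchHeight (w (i, j)))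
    (hv : rowTile (w (i - 1, j)) (w (i, j)) (w (i + 1, j)) a b = some v) :
    x (L.pos (i, j) + patchOffset a b - (8, 0)) = v := by
  have hl := (h (i - 1) j).1
  have hc := (h i j).1
  rw [sub_add_cancel] at hl
  have hl' := patchWidth_bounds (w (i - 1, j))
  have hr' := patchWidth_bounds (w (i + 1, j))
  have hbl := h.patchHeight_eq i (i - 1) j
  have hbr := h.patchHeight_eq i (i + 1) j
  unfold rowTile at hv
  split_ifs at hv with h1 h2 h3 h4 <;> rw [Option.some.injEq] at hv <;> rw [← hv]
  · rw [← h.tile_eq (i - 1, j) (by omega) (by omega)]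
    congr 1
    ext <;> simp [Layout.pos, patchOffset]; omega
  · rw [← h.tile_eq (i, j) (by omega) (by omega)]
    congr 1
    ext <;> simp [Layout.pos, patchOffset]; omega
  · rw [← h.tile_eq (i + 1, j) (by omega) (by omega)]
    congr 1
    ext <;> simp [Layout.pos, patchOffset]; omega

theorem relativeTile_spec {n : ℤ × ℤ} {a b dx dy : ℕ} {v : Fin 11}
    (hv : relativeTile (quadAt w (n - (1, 0))) (quadAt w n) a b dx dy = some v) :
    x (L.pos n + patchOffset a b + ((dx : ℤ) - 8, (dy : ℤ))) = v := by
  obtain ⟨i, j⟩ := n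
  -- A truncated subtraction yields index 0, where nothing is returned; a returned tile therefore
  -- comes from a genuine difference.
  have hz : ∀ l c r b, rowTile l c r 0 b = none := fun l c r b => by simp [rowTile]
  simp only [relativeTile, quadAt, Prod.mk_sub_mk, Prod.mk_add_mk, sub_zero, add_zero,
    sub_add_cancel] at hv
  have hS := (h i j).2.1
  have hY := (h i j).2.2.1
  have hH := patchHeight_bounds (w (i, j + 1))
  split_ifs at hv with h1 h2
  · rw [← h.rowTile_spec h1 hv]
    have : patchShear b + a + dx - patchShear (b + dy) ≠ 0 := fun h0 => by
      rw [h0, hz] at hv; cases hv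
    congr 1
    ext <;> simp [Layout.pos, patchOffset]
    · omega
    · omega
  · rw [← h.rowTile_spec (by omega) hv]
    generalize hc : patchShear b + a + dx - patchShear (patchHeight (w (i, j))) -
      patchShear (b + dy - patchHeight (w (i, j))) = c at hv ⊢
    have : c ≠ 0 := fun h0 => by
      rw [h0, hz] at hv; cases hv
    congr 1
    ext <;> simp [Layout.pos, patchOffset] <;> omega

/-- A cell and its right and upper neighbors lie in a 3 × 2 arrangement of patches, and all such
arrangements have been checked. -/
theorem mem_wangShift (hw : w ∈ wangShift tilesU) : x ∈ wangShift jeandelRao := by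
  intro m
  obtain ⟨n, a, b, ha, hb, rfl⟩ := h.exists_coord m
  have hl := quadAt_mem_quads hw (n - (1, 0))
  have hr := quadAt_mem_quads hw n
  have hadj := quadAt_adjRight w (n - (1, 0))
  rw [sub_add_cancel] at hadj
  have h1 := List.all_eq_true.1 (List.all_eq_true.1 patches_match_right _ hl) _ hr
  have h2 := List.all_eq_true.1 (List.all_eq_true.1 patches_match_top _ hl) _ hr
  rw [hadj, Bool.not_true, Bool.false_or] at h1 h2
  have h1 := forallTiles_iff.1 h1 a b ha hb
  have h2 := forallTiles_iff.1 h2 a b ha hb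
  rw [h.tile_eq n ha hb]
  constructor
  · split at h1
    · next v hv =>
      have := h.relativeTile_spec hv
      norm_num at this
      rw [this]; exact of_decide_eq_true h1
    · cases h1
  · split at h2
    · next v hv =>
      have := h.relativeTile_spec hv
      norm_num at this
      rw [this]; exact of_decide_eq_true h2
    · cases h2

end IsPatchwork

/-! ### The patches and their occurrences -/

/-- The patch of index `t`. -/
def wangPatch (t : Fin 19) : Patch (Fin 11) where
  support := (Finset.range (patchWidth t) ×ˢ Finset.range (patchHeight t)).image
    fun p => patchOffset p.1 p.2
  val m := patchTile t (m.1.1 - patchShear m.1.2.toNat).toNat m.1.2.toNat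

theorem mem_support_wangPatch {t : Fin 19} {m : ℤ × ℤ} : m ∈ (wangPatch t).support ↔
    ∃ a b : ℕ, a < patchWidth t ∧ b < patchHeight t ∧ m = patchOffset a b := by
  simp only [wangPatch, Finset.mem_image, Finset.mem_product, Finset.mem_range, Prod.exists]
  exact ⟨fun ⟨a, b, h1, h2⟩ => ⟨a, b, h1.1, h1.2, h2.symm⟩,
    fun ⟨a, b, h1, h2, h3⟩ => ⟨a, b, ⟨h1, h2⟩, h3.symm⟩⟩

theorem wangPatch_val {t : Fin 19} {a b : ℕ} (m : (wangPatch t).support)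
    (hm : (m : ℤ × ℤ) = patchOffset a b) : (wangPatch t).val m = patchTile t a b := by
  simp [wangPatch, hm, patchOffset]

theorem zero_mem_support (t : Fin 19) : (0, 0) ∈ (wangPatch t).support :=
  mem_support_wangPatch.2 ⟨0, 0, by have := patchWidth_bounds t; omega,
    by have := patchHeight_bounds t; omega, rfl⟩

theorem wangPatch_size (t : Fin 19) : (wangPatch t).size = patchWidth t * patchHeight t := by
  rw [Patch.size, wangPatch, Finset.card_image_of_injective, Finset.card_product,
    Finset.card_range, Finset.card_range]
  rintro ⟨a, b⟩ ⟨a', b'⟩ hab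
  obtain ⟨rfl, rfl⟩ := patchOffset_injective hab
  rfl

theorem wangPatch_occursAt_iff {t : Fin 19} {x : ℤ × ℤ → Fin 11} {k : ℤ × ℤ} :
    (wangPatch t).OccursAt x k ↔ ∀ a b, a < patchWidth t → b < patchHeight t →
      x (k + patchOffset a b) = patchTile t a b := by
  constructor
  · intro h a b ha hb
    have hm := mem_support_wangPatch.2 ⟨a, b, ha, hb, rfl⟩
    rw [← wangPatch_val ⟨_, hm⟩ rfl]
    exact h ⟨_, hm⟩
  · rintro h ⟨m, hm⟩
    obtain ⟨a, b, ha, hb, rfl⟩ := mem_support_wangPatch.1 hm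
    rw [wangPatch_val _ rfl]
    exact h a b ha hb

theorem patchTile_ne {t u : Fin 19} (hW : patchWidth t = patchWidth u)
    (hH : patchHeight t = patchHeight u)
    (he : ∀ a b, a < patchWidth t → b < patchHeight t → patchTile t a b = patchTile u a b) :
    t = u := by
  have := List.all_eq_true.1 (List.all_eq_true.1 patchTile_injective t (List.mem_finRange t)) u
    (List.mem_finRange u)
  have hW' : isNarrow t = isNarrow u := by
    unfold patchWidth at hW; split_ifs at hW <;> simp_all
  have hH' : isShort t = isShort u := by
    unfold patchHeight at hH; split_ifs at hH <;> simp_all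
  have he' : (forallTiles t fun a b => patchTile t a b == patchTile u a b) = true :=
    forallTiles_iff.2 fun a b ha hb => beq_iff_eq.2 (he a b ha hb)
  rw [hW', hH', he'] at this
  simpa using this

theorem not_isTranslate {t u : Fin 19} (htu : t ≠ u) :
    ¬ (wangPatch t).IsTranslate (wangPatch u) := by
  rintro ⟨k, hk, hval⟩
  -- The origin is the leftmost cell of the bottom row of every patch, which forces the translation
  -- to be zero.
  have hnonneg : ∀ (s : Fin 19) (m : ℤ × ℤ), m ∈ (wangPatch s).support → 0 ≤ m.2 ∧
      (m.2 = 0 → 0 ≤ m.1) := fun s m hm => by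
    obtain ⟨a, b, -, -, rfl⟩ := mem_support_wangPatch.1 hm
    simp only [patchOffset]; omega
  have h1 := hnonneg u _ ((hk (0, 0)).1 (zero_mem_support t))
  have h2 := hnonneg t (-k) ((hk (-k)).2 (by rw [add_neg_cancel]; exact zero_mem_support u))
  obtain rfl : k = 0 := by
    simp at h1 h2
    ext <;> simp <;> omega
  simp only [zero_add] at hk hval
  have hsub : ∀ {s s' : Fin 19}, (∀ m, m ∈ (wangPatch s).support → m ∈ (wangPatch s').support) →
      ∀ a b, a < patchWidth s → b < patchHeight s → a < patchWidth s' ∧ b < patchHeight s' := by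
    intro s s' hs a b ha hb
    obtain ⟨a', b', ha', hb', he⟩ :=
      mem_support_wangPatch.1 (hs _ (mem_support_wangPatch.2 ⟨a, b, ha, hb, rfl⟩))
    obtain ⟨rfl, rfl⟩ := patchOffset_injective he
    exact ⟨ha', hb'⟩
  have hW := patchWidth_bounds t
  have hW' := patchWidth_bounds u
  have hH := patchHeight_bounds t
  have hH' := patchHeight_bounds u
  -- Comparing the far corner cells in both directions forces equal widths and heights.
  have h3 := hsub (fun m => (hk m).1) (patchWidth t - 1) (patchHeight t - 1) (by omega) (by omega)
  have h4 := hsub (fun m => (hk m).2) (patchWidth u - 1) (patchHeight u - 1) (by omega) (by omega)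
  refine htu (patchTile_ne (by omega) (by omega) fun a b ha hb => ?_)
  have hm := mem_support_wangPatch.2 ⟨a, b, ha, hb, rfl⟩
  have := hval ⟨_, hm⟩ ⟨_, (hk _).1 hm⟩ rfl
  rw [wangPatch_val _ rfl, wangPatch_val _ rfl] at this
  exact this.symm

/-! ### Decompositions -/

/-- Ensures that the natural-number subtractions in `signatures_rigid` are not truncated. -/
theorem signatures_shear {a b a' b' : ℕ} {s s' : Fin 11}
    (h : (a, b, s, a', b', s') ∈ signatures) : b ≤ b' ∧
      a + patchShear b ≤ a' + patchShear b' + 8 := by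
  simp only [signatures, List.mem_cons, Prod.mk.injEq, List.not_mem_nil, or_false] at h
  obtain ⟨rfl, rfl, -, rfl, rfl, -⟩ | ⟨rfl, rfl, -, rfl, rfl, -⟩ | ⟨rfl, rfl, -, rfl, rfl, -⟩ |
    ⟨rfl, rfl, -, rfl, rfl, -⟩ := h <;> decide

/-- Where the patches are placed and which letters they have, as a set. -/
def patchSet (w : ℤ × ℤ → Fin 19) (L : Layout) : Set ((ℤ × ℤ) × Fin 19) :=
  Set.range fun n => (L.pos n, w n)

namespace IsPatchwork

variable {x : ℤ × ℤ → Fin 11} {w : ℤ × ℤ → Fin 19} {L : Layout} (h : IsPatchwork x w L)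

include h

theorem isDecomposition : IsDecomposition wangPatch x (patchSet w L) := by
  constructor
  · rintro _ ⟨n, rfl⟩
    exact wangPatch_occursAt_iff.2 fun a b => h.tile_eq n
  · intro m
    obtain ⟨n, a, b, ha, hb, rfl⟩ := h.exists_coord m
    refine ⟨(L.pos n, w n), ⟨⟨n, rfl⟩, mem_support_wangPatch.2 ⟨a, b, ha, hb, by simp⟩⟩, ?_⟩
    rintro _ ⟨⟨n', rfl⟩, hm⟩
    obtain ⟨a', b', ha', hb', he⟩ := mem_support_wangPatch.1 hm
    obtain ⟨rfl, -, -⟩ := h.coord_unique ha' hb' ha hb (by rw [← he]; simp)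
    rfl

/-- The two tiles of a signature of `t` occur in `x`. By rigidity the first has its own coordinates
in the patch of `w` that contains it, so both patches start at the same cell. -/
theorem exists_pos_eq (hw : w ∈ wangShift tilesU) {t : Fin 19} {k : ℤ × ℤ}
    (hk : (wangPatch t).OccursAt x k) : ∃ n, k = L.pos n := by
  obtain ⟨⟨a, b, s, a', b', s'⟩, hσ, ht⟩ := List.any_eq_true.1
    (List.all_eq_true.1 exists_hasSignature t (List.mem_finRange t))
  simp only [hasSignature, Bool.and_eq_true, Nat.blt_eq, beq_iff_eq] at ht
  obtain ⟨⟨⟨⟨⟨ha, hb⟩, ha'⟩, hb'⟩, hs⟩, hs'⟩ := ht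
  rw [wangPatch_occursAt_iff] at hk
  have h1 := hk a b ha hb
  have h2 := hk a' b' ha' hb'
  rw [hs] at h1; rw [hs'] at h2
  obtain ⟨n, p, q, hp, hq, he⟩ := h.exists_coord (k + patchOffset a b)
  have hadj := quadAt_adjRight w (n - (1, 0))
  rw [sub_add_cancel] at hadj
  have := List.all_eq_true.1 (List.all_eq_true.1 (List.all_eq_true.1 signatures_rigid _ hσ) _
    (quadAt_mem_quads hw (n - (1, 0)))) _ (quadAt_mem_quads hw n)
  rw [hadj, Bool.not_true, Bool.false_or] at this
  have := forallTiles_iff.1 this p q hp hq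
  rw [he] at h1
  have hpq : patchTile (w n) p q = s := by rw [← h.tile_eq n hp hq, h1]
  have hpq' : patchTile (quadAt w n).1 p q = s := hpq
  rw [hpq', beq_self_eq_true, Bool.not_true, Bool.false_or, Bool.or_eq_true] at this
  obtain hab | hrel := this
  · simp only [Bool.and_eq_true, beq_iff_eq] at hab
    obtain ⟨rfl, rfl⟩ := hab
    exact ⟨n, add_right_cancel he⟩
  · split at hrel
    · next v hv =>
      exfalso
      have h3 := h.relativeTile_spec hv
      rw [← he] at h3
      obtain ⟨hbb, haa⟩ := signatures_shear hσ
      have e : k + patchOffset a b + (((a' + patchShear b' + 8 - (a + patchShear b) : ℕ) : ℤ) - 8,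
          ((b' - b : ℕ) : ℤ)) = k + patchOffset a' b' := by
        rw [Nat.cast_sub haa, Nat.cast_sub hbb]
        ext <;> simp [patchOffset]
        ring
      rw [e, h2] at h3
      simp [h3] at hrel
    · cases hrel

theorem exists_mem_decomposition (hw : w ∈ wangShift tilesU) {D : Set ((ℤ × ℤ) × Fin 19)}
    (hD : IsDecomposition wangPatch x D) (n : ℤ × ℤ) : ∃ t, (L.pos n, t) ∈ D ∧
      patchWidth (w n) ≤ patchWidth t ∧ patchHeight (w n) ≤ patchHeight t := by
  have hW := patchWidth_bounds (w n)
  have hH := patchHeight_bounds (w n)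
  -- The patch of `D` covering the far corner of patch `n` must start at `L.pos n`: starting
  -- earlier, it would be at least 10 wide or 18 high, against the maxima 8 and 14.
  obtain ⟨⟨k, t⟩, ⟨hdD, hd⟩, -⟩ :=
    hD.2 (L.pos n + patchOffset (patchWidth (w n) - 1) (patchHeight (w n) - 1))
  obtain ⟨n', rfl⟩ := h.exists_pos_eq hw (hD.1 _ hdD)
  obtain ⟨a, b, ha, hb, he⟩ := mem_support_wangPatch.1 hd
  dsimp only at ha hb
  have hWt := patchWidth_bounds t
  have hHt := patchHeight_bounds t
  obtain ⟨i, j⟩ := n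
  obtain ⟨i', j'⟩ := n'
  simp only [Layout.pos, patchOffset, Prod.mk_add_mk, Prod.mk_sub_mk, Prod.mk.injEq] at he
  have hY := (h i j).2.2.1
  have hX := (h i j).1
  have hj : j' ≤ j := by
    by_contra hlt
    have := h.Y_strictMono.monotone (show j + 1 ≤ j' by omega)
    omega
  obtain rfl : j' = j := by
    by_contra hne
    have := h.Y_strictMono.monotone (show j' + 1 ≤ j by omega)
    have := (h i' j').2.2.1
    have := patchHeight_bounds (w (i', j'))
    omega
  obtain rfl : b = patchHeight (w (i, j')) - 1 := by omega
  have hi : i' ≤ i := by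
    by_contra hlt
    have := h.X_strictMono.monotone (show i + 1 ≤ i' by omega)
    omega
  obtain rfl : i' = i := by
    by_contra hne
    have := h.X_strictMono.monotone (show i' + 1 ≤ i by omega)
    have := (h i' j').1
    have := patchWidth_bounds (w (i', j'))
    omega
  exact ⟨t, hdD, by omega, by omega⟩

/-- Every start of a patch of the patchwork is a start in `D`, and no patch of `D` may cover a
second start; this fixes the sizes, and the tiles then fix the letters. -/
theorem decomposition_unique (hw : w ∈ wangShift tilesU) {D : Set ((ℤ × ℤ) × Fin 19)}
    (hD : IsDecomposition wangPatch x D) : D = patchSet w L := by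
  have hself : ∀ {k : ℤ × ℤ} {t : Fin 19}, (k, t) ∈ D →
      ∀ {k' : ℤ × ℤ} {t' : Fin 19}, (k', t') ∈ D → k - k' ∈ (wangPatch t').support →
      (k, t) = (k', t') := fun {k t} hk {k' t'} hk' hsupp =>
    (hD.2 k).unique ⟨hk, by rw [sub_self]; exact zero_mem_support t⟩ ⟨hk', hsupp⟩
  have hmem : ∀ n, (L.pos n, w n) ∈ D := by
    intro n
    obtain ⟨t, ht, hW, hH⟩ := h.exists_mem_decomposition hw hD n
    obtain ⟨t₁, ht₁, -⟩ := h.exists_mem_decomposition hw hD (n + (1, 0))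
    obtain ⟨t₂, ht₂, -⟩ := h.exists_mem_decomposition hw hD (n + (0, 1))
    have hW' : patchWidth (w n) = patchWidth t := by
      by_contra hne
      -- A wider patch would cover the first cell of the right neighbor, where another patch of `D`
      -- starts.
      have := patchHeight_bounds t
      have := hself ht₁ ht (mem_support_wangPatch.2 ⟨patchWidth (w n), 0, by omega, by omega, by
        rw [h.pos_right]; simp [patchOffset, patchShear]⟩)
      have := h.pos_injective (congrArg Prod.fst this)
      simp at this
    have hH' : patchHeight (w n) = patchHeight t := by
      by_contra hne
      have := patchWidth_bounds t
      have := hself ht₂ ht (mem_support_wangPatch.2 ⟨0, patchHeight (w n), by omega, by omega, by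
        rw [h.pos_up]; simp [patchOffset]⟩)
      have := h.pos_injective (congrArg Prod.fst this)
      simp at this
    rw [patchTile_ne hW' hH' fun a b ha hb => ?_]
    · exact ht
    · rw [← h.tile_eq n ha hb]
      exact wangPatch_occursAt_iff.1 (hD.1 _ ht) a b (hW' ▸ ha) (hH' ▸ hb)
  refine Set.Subset.antisymm ?_ (Set.range_subset_iff.2 hmem)
  rintro ⟨k, t⟩ hd
  obtain ⟨n, rfl⟩ := h.exists_pos_eq hw (hD.1 _ hd)
  exact ⟨n, hself (hmem n) hd (by rw [sub_self]; exact zero_mem_support t)⟩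

end IsPatchwork

/-- The displacement from a patch to its right neighbor. -/
def patchRight (t : Fin 19) : ℤ × ℤ := (patchWidth t, 0)

/-- The displacement from a patch to its upper neighbor. -/
def patchUp (t : Fin 19) : ℤ × ℤ := (patchShear (patchHeight t), patchHeight t)

namespace IsPatchwork

variable {x : ℤ × ℤ → Fin 11} {w : ℤ × ℤ → Fin 19} {L : Layout} (h : IsPatchwork x w L)

include h

theorem isArrangedAs : IsArrangedAs patchRight patchUp (patchSet w L) w :=
  ⟨L.pos, h.pos_injective, h.pos_right, h.pos_up, rfl⟩

/-- A set of patches arranged as `w'` that is contained in the patchwork. -/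
theorem exists_index {w' : ℤ × ℤ → Fin 19} {p : ℤ × ℤ → ℤ × ℤ}
    (hr : ∀ n, p (n + (1, 0)) = p n + patchRight (w' n))
    (hu : ∀ n, p (n + (0, 1)) = p n + patchUp (w' n)) (hp : ∀ n, (p n, w' n) ∈ patchSet w L) :
    ∃ f : ℤ × ℤ → ℤ × ℤ, (∀ n, L.pos (f n) = p n) ∧ (∀ n, w (f n) = w' n) ∧
      (∀ n, f (n + (1, 0)) = f n + (1, 0)) ∧ ∀ n, f (n + (0, 1)) = f n + (0, 1) := by
  choose f hf using hp
  simp only [Prod.mk.injEq] at hf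
  refine ⟨f, fun n => (hf n).1, fun n => (hf n).2, fun n => h.pos_injective ?_,
    fun n => h.pos_injective ?_⟩
  · rw [(hf _).1, hr, h.pos_right, (hf n).1, (hf n).2]; rfl
  · rw [(hf _).1, hu, h.pos_up, (hf n).1, (hf n).2]; rfl

theorem mem_wangShift_of_isArrangedAs (hw : w ∈ wangShift tilesU) {w' : ℤ × ℤ → Fin 19}
    (h' : IsArrangedAs patchRight patchUp (patchSet w L) w') : w' ∈ wangShift tilesU := by
  obtain ⟨p, -, hr, hu, hp⟩ := h'
  obtain ⟨f, -, hf, hf₁, hf₂⟩ := h.exists_index hr hu fun n => by rw [hp]; exact ⟨n, rfl⟩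
  intro n
  have := hw (f n)
  rwa [← hf₁, ← hf₂, hf, hf, hf] at this

/-- The same patches, with shifted indices, and with the patch of index `n` moved to the origin. -/
theorem shift_pos (n : ℤ × ℤ) : IsPatchwork (shift (L.pos n) x) (shift n w)
    ⟨fun i => L.X (i + n.1) - L.X n.1, fun j => L.S (j + n.2) - L.S n.2,
      fun j => L.Y (j + n.2) - L.Y n.2⟩ := by
  intro i j
  obtain ⟨h1, h2, h3, h4⟩ := h (i + n.1) (j + n.2)
  have e : shift n w (i, j) = w (i + n.1, j + n.2) := rfl
  rw [e]
  refine ⟨by simp only [add_right_comm i 1, h1]; ring, by simp only [add_right_comm j 1, h2]; ring,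
    by simp only [add_right_comm j 1, h3]; ring, fun a b ha hb => ?_⟩
  rw [← h4 a b ha hb]
  simp only [shift]
  congr 1
  ext <;> simp [Layout.pos] <;> ring

theorem translate (k : ℤ × ℤ) : IsPatchwork (shift k x) w
    ⟨fun i => L.X i - k.1, L.S, fun j => L.Y j - k.2⟩ := by
  intro i j
  obtain ⟨h1, h2, h3, h4⟩ := h i j
  refine ⟨by simp only [h1]; ring, h2, by simp only [h3]; ring, fun a b ha hb => ?_⟩
  rw [← h4 a b ha hb]
  simp only [shift]
  congr 1
  ext <;> simp [Layout.pos] <;> ring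

/-- The translated patchwork decomposes the same configuration. Uniqueness turns the period into a
translation of indices that fixes `w`, which must be zero. -/
theorem eq_zero_of_period (hw : w ∈ wangShift tilesU) {k : ℤ × ℤ} (hk : shift k x = x) :
    k = 0 := by
  have hs := h.translate k
  rw [hk] at hs
  obtain ⟨f, hf, hfw, hf₁, hf₂⟩ := h.exists_index hs.pos_right hs.pos_up fun n => by
    rw [← h.decomposition_unique hw hs.isDecomposition]; exact ⟨n, rfl⟩
  have hf0 : ∀ n, f n = n + f 0 := by
    rintro ⟨i, j⟩
    have h1 := int_const_of_succ (f := fun i => f (i, j) - (i, 0)) (fun i => by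
      have := hf₁ (i, j)
      simp only [Prod.mk_add_mk, add_zero] at this
      rw [this]; ext <;> simp) i
    have h2 := int_const_of_succ (f := fun j => f (0, j) - (0, j)) (fun j => by
      have := hf₂ (0, j)
      simp only [Prod.mk_add_mk, add_zero] at this
      rw [this]; ext <;> simp) j
    simp only [Prod.mk_zero_zero, sub_zero] at h1 h2
    rw [← h2, ← h1]; ext <;> simp
  have h0 : f 0 = 0 := _root_.eq_zero_of_period hw (funext fun n => by
    rw [← hfw n, hf0 n]; rfl)
  have := hf 0
  rw [h0] at this
  simp only [Layout.pos, Prod.fst_zero, Prod.snd_zero, Prod.mk.injEq] at this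
  ext <;> simp <;> omega

end IsPatchwork

/-! ### The subshift of patchworks -/

/-- The layout of the patches of indices `w n` with the patch of index `0` at the origin. -/
def standardLayout (w : ℤ × ℤ → Fin 19) : Layout where
  X := partialSum fun i => patchWidth (w (i, 0))
  S := partialSum fun j => patchShear (patchHeight (w (0, j)))
  Y := partialSum fun j => patchHeight (w (0, j))

theorem eq_partialSum {f a : ℤ → ℤ} (h0 : f 0 = 0) (h : ∀ k, f (k + 1) = f k + a k) :
    f = partialSum a := by
  funext k
  have := int_const_of_succ (f := fun k => f k - partialSum a k) (fun k => by
    simp only [h, partialSum_succ]; ring) k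
  simp only [h0, partialSum_zero] at this
  omega

theorem IsPatchwork.eq_standardLayout {x : ℤ × ℤ → Fin 11} {w : ℤ × ℤ → Fin 19} {L : Layout}
    (h : IsPatchwork x w L) (hX : L.X 0 = 0) (hS : L.S 0 = 0) (hY : L.Y 0 = 0) :
    L = standardLayout w := by
  obtain ⟨X, S, Y⟩ := L
  rw [standardLayout, ← eq_partialSum hX fun i => (h i 0).1,
    ← eq_partialSum hS fun j => (h 0 j).2.1, ← eq_partialSum hY fun j => (h 0 j).2.2.1]

/-- A patchwork, seen from the origin of the patch of index `n`. -/
theorem IsPatchwork.standard_shift {x : ℤ × ℤ → Fin 11} {w : ℤ × ℤ → Fin 19} {L : Layout}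
    (h : IsPatchwork x w L) (n : ℤ × ℤ) :
    IsPatchwork (shift (L.pos n) x) (shift n w) (standardLayout (shift n w)) := by
  have := h.shift_pos n
  rwa [this.eq_standardLayout (by simp) (by simp) (by simp)] at this

theorem IsPatchwork.unique {x y : ℤ × ℤ → Fin 11} {w : ℤ × ℤ → Fin 19} {L : Layout}
    (h : IsPatchwork x w L) (h' : IsPatchwork y w L) : x = y := by
  funext m
  obtain ⟨n, a, b, ha, hb, rfl⟩ := h.exists_coord m
  rw [h.tile_eq n ha hb, h'.tile_eq n ha hb]

theorem exists_isPatchwork {w : ℤ × ℤ → Fin 19} (hw : w ∈ wangShift tilesU) :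
    ∃ x, IsPatchwork x w (standardLayout w) := by
  set L := standardLayout w with hL
  have hW : ∀ i j, patchWidth (w (i, j)) = patchWidth (w (i, 0)) := fun i j => by
    rw [patchWidth, patchWidth, isNarrow_column hw]
  have hH : ∀ i j, patchHeight (w (i, j)) = patchHeight (w (0, j)) := fun i j => by
    rw [patchHeight, patchHeight, isShort_row hw]
  have hX : StrictMono L.X := partialSum_strictMono (a := fun i => patchWidth (w (i, 0))) fun i => by
    have := patchWidth_bounds (w (i, 0)); omega
  have hY : StrictMono L.Y := partialSum_strictMono (a := fun j => patchHeight (w (0, j))) fun j => by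
    have := patchHeight_bounds (w (0, j)); omega
  -- These invert the parametrization of cells by patch index and coordinates: the row first, then
  -- the column after undoing the shears.
  let row : ℤ × ℤ → ℤ := fun m => intervalIndex L.Y m.2
  let b : ℤ × ℤ → ℕ := fun m => (m.2 - L.Y (row m)).toNat
  let col : ℤ × ℤ → ℤ := fun m => m.1 - L.S (row m) - patchShear (b m)
  let i : ℤ × ℤ → ℤ := fun m => intervalIndex L.X (col m)
  refine ⟨fun m => patchTile (w (i m, row m)) (col m - L.X (i m)).toNat (b m), fun k l => ?_⟩
  have h1 : L.X (k + 1) = L.X k + patchWidth (w (k, l)) := by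
    rw [hW]; exact partialSum_succ (fun i => patchWidth (w (i, 0))) k
  have h2 : L.S (l + 1) = L.S l + patchShear (patchHeight (w (k, l))) := by
    rw [hH]; exact partialSum_succ (fun j => patchShear (patchHeight (w (0, j)))) l
  have h3 : L.Y (l + 1) = L.Y l + patchHeight (w (k, l)) := by
    rw [hH]; exact partialSum_succ (fun j => patchHeight (w (0, j))) l
  refine ⟨h1, h2, h3, fun p q hp hq => ?_⟩
  set m := L.pos (k, l) + patchOffset p q with hm
  have hm1 : m.1 = L.X k + L.S l + (patchShear q + p) := rfl
  have hm2 : m.2 = L.Y l + q := rfl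
  have hrow : row m = l := intervalIndex_eq hY (by omega) (by omega)
  have hb : b m = q := by simp only [b, hrow]; omega
  have hcol : col m = L.X k + p := by simp only [col, hrow, hb]; omega
  have hi : i m = k := intervalIndex_eq hX (by omega) (by omega)
  simp only [hrow, hb, hcol, hi, add_sub_cancel_left, Int.toNat_natCast]

/-- The configurations composed of patches that are arranged like a tiling by `𝒰`. -/
def patchworks : Set (ℤ × ℤ → Fin 11) :=
  {x | ∃ w ∈ wangShift tilesU, ∃ L, IsPatchwork x w L}

theorem shift_mem_patchworks {x : ℤ × ℤ → Fin 11} (hx : x ∈ patchworks) (k : ℤ × ℤ) :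
    shift k x ∈ patchworks := by
  obtain ⟨w, hw, L, h⟩ := hx
  exact ⟨w, hw, _, h.translate k⟩

/-- The pairs of a tiling by `𝒰` and the corresponding patchwork. -/
def standardPatchworks : Set ((ℤ × ℤ → Fin 11) × (ℤ × ℤ → Fin 19)) :=
  {p | p.2 ∈ wangShift tilesU ∧ IsPatchwork p.1 p.2 (standardLayout p.2)}

theorem continuous_partialSum {α : Type*} [TopologicalSpace α] {a : α → ℤ → ℤ}
    (ha : ∀ k, Continuous fun z => a z k) (k : ℤ) : Continuous fun z => partialSum (a z) k := by
  obtain n | n := k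
  · exact continuous_finsetSum _ fun i _ => ha i
  · exact (continuous_finsetSum _ fun i _ => ha _).neg

/-- Each value of the layout is a finite sum of functions of single letters of `w`, hence
continuous, so every condition is closed. -/
theorem isClosed_standardPatchworks : IsClosed standardPatchworks := by
  have hsnd : ∀ n, Continuous fun p : (ℤ × ℤ → Fin 11) × (ℤ × ℤ → Fin 19) => p.2 n :=
    fun n => by fun_prop
  have hcomp : ∀ (f : Fin 19 → ℕ) n,
      Continuous fun p : (ℤ × ℤ → Fin 11) × (ℤ × ℤ → Fin 19) => ((f (p.2 n) : ℕ) : ℤ) :=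
    fun f n => (continuous_of_discreteTopology (f := fun t => ((f t : ℕ) : ℤ))).comp (hsnd n)
  have hX : ∀ k, Continuous fun p : (ℤ × ℤ → Fin 11) × (ℤ × ℤ → Fin 19) =>
      (standardLayout p.2).X k := continuous_partialSum fun i => hcomp patchWidth (i, 0)
  have hS : ∀ k, Continuous fun p : (ℤ × ℤ → Fin 11) × (ℤ × ℤ → Fin 19) =>
      (standardLayout p.2).S k :=
    continuous_partialSum fun j => hcomp (fun t => patchShear (patchHeight t)) (0, j)
  have hY : ∀ k, Continuous fun p : (ℤ × ℤ → Fin 11) × (ℤ × ℤ → Fin 19) =>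
      (standardLayout p.2).Y k := continuous_partialSum fun j => hcomp patchHeight (0, j)
  have heval : Continuous fun q : (ℤ × ℤ → Fin 11) × (ℤ × ℤ) => q.1 q.2 :=
    continuous_prod_of_discrete_right.2 fun m => continuous_apply m
  have : standardPatchworks = {p | p.2 ∈ wangShift tilesU} ∩ ⋂ i : ℤ, ⋂ j : ℤ,
      {p | (standardLayout p.2).X (i + 1) = (standardLayout p.2).X i + patchWidth (p.2 (i, j))} ∩
      ({p | (standardLayout p.2).S (j + 1) =
        (standardLayout p.2).S j + patchShear (patchHeight (p.2 (i, j)))} ∩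
      ({p | (standardLayout p.2).Y (j + 1) =
        (standardLayout p.2).Y j + patchHeight (p.2 (i, j))} ∩
      ⋂ a : ℕ, ⋂ b : ℕ, {p | a < patchWidth (p.2 (i, j)) → b < patchHeight (p.2 (i, j)) →
        p.1 ((standardLayout p.2).pos (i, j) + patchOffset a b) = patchTile (p.2 (i, j)) a b})) := by
    ext p
    simp [standardPatchworks, IsPatchwork]
  rw [this]
  refine ((isClosed_wangShift tilesU).preimage continuous_snd).inter
    (isClosed_iInter fun i => isClosed_iInter fun j => ?_)
  refine (isClosed_eq (hX _) ((hX _).add (hcomp patchWidth _))).inter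
    ((isClosed_eq (hS _) ((hS _).add (hcomp (fun t => patchShear (patchHeight t)) _))).inter
    ((isClosed_eq (hY _) ((hY _).add (hcomp patchHeight _))).inter
    (isClosed_iInter fun a => isClosed_iInter fun b => ?_)))
  have hpos : Continuous fun p : (ℤ × ℤ → Fin 11) × (ℤ × ℤ → Fin 19) =>
      (standardLayout p.2).pos (i, j) + patchOffset a b :=
    (((hX i).add (hS j)).prodMk (hY j)).add continuous_const
  exact (isClosed_discrete {r : Fin 19 × Fin 11 | a < patchWidth r.1 → b < patchHeight r.1 →
    r.2 = patchTile r.1 a b}).preimage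
    ((hsnd (i, j)).prodMk (heval.comp (continuous_fst.prodMk hpos)))

theorem continuous_shift {A : Type} [TopologicalSpace A] (k : ℤ × ℤ) :
    Continuous (shift k : (ℤ × ℤ → A) → ℤ × ℤ → A) :=
  continuous_pi fun m => continuous_apply (m + k)

/-- The origin lies in some patch, at one of at most 8 × 14 coordinates. Thus the set is a finite
union of shifts of the projection of a compact set. -/
theorem isClosed_patchworks : IsClosed patchworks := by
  have hA : IsClosed (Prod.fst '' standardPatchworks) :=
    (isClosed_standardPatchworks.isCompact.image continuous_fst).isClosed
  have : patchworks = ⋃ κ ∈ (Finset.range 8 ×ˢ Finset.range 14 : Finset (ℕ × ℕ)),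
      shift (-patchOffset κ.1 κ.2) ⁻¹' (Prod.fst '' standardPatchworks) := by
    ext x
    simp only [Set.mem_iUnion, Set.mem_preimage, Set.mem_image, Prod.exists, exists_and_right,
      exists_eq_right, Finset.mem_product, Finset.mem_range]
    constructor
    · rintro ⟨w, hw, L, h⟩
      obtain ⟨n, a, b, ha, hb, he⟩ := h.exists_coord 0
      have hW := patchWidth_bounds (w n)
      have hH := patchHeight_bounds (w n)
      refine ⟨a, b, ⟨by omega, by omega⟩, shift n w, shift_mem_wangShift hw n, ?_⟩
      rw [← eq_neg_of_add_eq_zero_left he.symm]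
      exact h.standard_shift n
    · rintro ⟨a, b, -, w, hw, h⟩
      have := shift_mem_patchworks ⟨w, hw, _, h⟩ (patchOffset a b)
      rwa [shift_shift, add_neg_cancel, shift_zero] at this
  rw [this]
  exact isClosed_biUnion_finset fun κ _ => hA.preimage (continuous_shift _)

/-- The tilings paired with elements of `Y` form a nonempty subshift `Z` of the tilings by `𝒰`,
hence all of them. Since a tiling determines its standard patchwork, `Y` contains every patchwork.
-/
theorem isMinimalSubshift_patchworks : IsMinimalSubshift patchworks := by
  refine ⟨⟨isClosed_patchworks, isShiftInvariant_of_forall_mem fun x hx => shift_mem_patchworks hx⟩,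
    fun Y hYX ⟨y, hy⟩ hY => hYX.antisymm ?_⟩
  have hstd : ∀ {x w L}, w ∈ wangShift tilesU → IsPatchwork x w L → ∀ n,
      (shift (L.pos n) x, shift n w) ∈ standardPatchworks := fun hw h n =>
    ⟨shift_mem_wangShift hw n, h.standard_shift n⟩
  set Z : Set (ℤ × ℤ → Fin 19) := Prod.snd '' (standardPatchworks ∩ Prod.fst ⁻¹' Y) with hZ
  have hmem : ∀ {x w L}, x ∈ Y → w ∈ wangShift tilesU → IsPatchwork x w L → ∀ n,
      shift n w ∈ Z := fun hx hw h n =>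
    ⟨_, ⟨hstd hw h n, shift_mem_of_isShiftInvariant hY.2 hx _⟩, rfl⟩
  have hZeq : Z = wangShift tilesU := by
    refine isMinimalSubshift_tilesU.2 Z ?_ ?_ ⟨?_, isShiftInvariant_of_forall_mem ?_⟩
    · rintro _ ⟨p, ⟨hp, -⟩, rfl⟩; exact hp.1
    · obtain ⟨w, hw, L, h⟩ := hYX hy
      exact ⟨_, hmem hy hw h 0⟩
    · exact ((isClosed_standardPatchworks.inter (hY.1.preimage continuous_fst)).isCompact.image
        continuous_snd).isClosed
    · rintro _ ⟨p, ⟨hp, hpY⟩, rfl⟩ n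
      exact hmem hpY hp.1 hp.2 n
  rintro x ⟨w, hw, L, h⟩
  obtain ⟨⟨y', w'⟩, ⟨hp, hpY⟩, hw'⟩ := hZeq.ge hw
  obtain rfl : w' = w := hw'
  have h0 := h.standard_shift 0
  rw [shift_zero] at h0
  have := shift_mem_of_isShiftInvariant hY.2 hpY (-L.pos 0)
  rwa [← h0.unique hp.2, shift_shift, neg_add_cancel, shift_zero] at this

/-! ### The main theorem -/

theorem exists_mem_patchSet {w : ℤ × ℤ → Fin 19} (hw : w ∈ wangShift tilesU) (L : Layout)
    (t : Fin 19) : ∃ k, (k, t) ∈ patchSet w L := by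
  obtain ⟨q, hq, ht⟩ := List.any_eq_true.1
    (List.all_eq_true.1 exists_quad_fst t (List.mem_finRange t))
  obtain ⟨n, hn⟩ := isRecurrent_of_mem_quads hq w hw
  refine ⟨L.pos n, n, ?_⟩
  rw [← beq_iff_eq.1 ht, ← hn]; rfl

theorem patchesEquivalentToTiles_patchworks :
    PatchesEquivalentToTiles patchworks wangPatch tilesU := by
  have hshear : ∀ t, patchShear (patchHeight t) = patchShear (patchHeight t - 1) + 1 := by
    intro t; unfold patchHeight; split <;> rfl
  refine ⟨patchRight, patchUp, fun t => ⟨zero_mem_support t, ?_, ?_⟩, ?_, fun w => ⟨fun hw => ?_, ?_⟩⟩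
  · have := patchWidth_bounds t
    have := patchHeight_bounds t
    refine mem_support_wangPatch.2 ⟨patchWidth t - 1, 0, by omega, by omega, ?_⟩
    ext <;> simp [patchRight, patchOffset, patchShear]; omega
  · have := patchWidth_bounds t
    have := patchHeight_bounds t
    -- The shear grows by one at the top of the patch, so the cell below the upper neighbor's origin
    -- is in column 1 of the top row.
    refine mem_support_wangPatch.2 ⟨1, patchHeight t - 1, by omega, by omega, ?_⟩
    ext <;> simp [patchUp, patchOffset, hshear]; omega
  · rintro x ⟨w, hw, L, h⟩
    exact ⟨w, hw, _, h.isDecomposition, h.isArrangedAs⟩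
  · obtain ⟨x, h⟩ := exists_isPatchwork hw
    exact ⟨x, ⟨w, hw, _, h⟩, _, h.isDecomposition, h.isArrangedAs⟩
  -- By uniqueness `D` is the decomposition of the patchwork for `w'`, so `w` is `w'` with
  -- translated indices.
  · rintro ⟨x, ⟨w', hw', L, h⟩, D, hD, hw⟩
    rw [h.decomposition_unique hw' hD] at hw
    exact h.mem_wangShift_of_isArrangedAs hw' hw

theorem mainTheorem2 :
    ∃ X₀ : Set (ℤ × ℤ → Fin 11),
      X₀ ⊆ wangShift jeandelRao ∧ IsAperiodic X₀ ∧ IsMinimalSubshift X₀ ∧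
      ∃ P : Fin 19 → Patch (Fin 11),
        (∀ i j, i ≠ j → ¬ (P i).IsTranslate (P j)) ∧
        (Finset.univ.filter fun i => (P i).size = 45).card = 2 ∧
        (Finset.univ.filter fun i => (P i).size = 70).card = 4 ∧
        (Finset.univ.filter fun i => (P i).size = 72).card = 6 ∧
        (Finset.univ.filter fun i => (P i).size = 112).card = 7 ∧
        (∀ x ∈ X₀, ∃! D, IsDecomposition P x D) ∧
        (∀ x ∈ X₀, ∀ D, IsDecomposition P x D → ∀ i, ∃ k, (k, i) ∈ D) ∧
        PatchesEquivalentToTiles X₀ P tilesU ∧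
        IsSelfSimilar (wangShift tilesU) := by
  refine ⟨patchworks, ?_, ⟨?_, ?_⟩, isMinimalSubshift_patchworks, wangPatch,
    fun i j => not_isTranslate, ?_, ?_, ?_, ?_, ?_, ?_, patchesEquivalentToTiles_patchworks,
    isSelfSimilar_tilesU⟩
  · rintro x ⟨w, hw, L, h⟩
    exact h.mem_wangShift hw
  · obtain ⟨w, hw⟩ := wangShift_tilesU_nonempty
    obtain ⟨x, h⟩ := exists_isPatchwork hw
    exact ⟨x, w, hw, _, h⟩
  · rintro x ⟨w, hw, L, h⟩ n hn hx
    exact hn (h.eq_zero_of_period hw hx)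
  -- The sizes are 5 · 9, 5 · 14, 8 · 9 and 8 · 14.
  · simp only [wangPatch_size]; decide +kernel
  · simp only [wangPatch_size]; decide +kernel
  · simp only [wangPatch_size]; decide +kernel
  · simp only [wangPatch_size]; decide +kernel
  · rintro x ⟨w, hw, L, h⟩
    exact ⟨_, h.isDecomposition, fun D => h.decomposition_unique hw⟩
  · rintro x ⟨w, hw, L, h⟩ D hD t
    rw [h.decomposition_unique hw hD]
    exact exists_mem_patchSet hw L t
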